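/- Let $\mathcal Y,\mathcal S$ be finite alphabets and let $(X_j,Y_j,S_j)_{j\in\mathbb Z}$ be a finite-state aperiodic irreducible Markov (FAIM) process: a strictly stationary process with $X_j\in\{0,1\}$, $Y_j\in\mathcal Y$, $S_j\in\mathcal S$ such that, for every $j$, conditioned on $S_{j-1}$ the variables $(X_k,Y_k,S_k)_{k\ge j}$ are jointly independent of the variables $(X_l,Y_l,S_{l-1})_{l<j}$, and such that the Markov chain $(S_j)$ on $\mathcal S$ is irreducible and aperiodic. For a binary random variable $U$ and a random variable $Q$ with finitely many values, with joint law $P_{U,Q}$, put $$Z(U|Q)=2\sum_q\sqrt{P_{U,Q}(0,q)P_{U,Q}(1,q)},\qquad K(U|Q)=\sum_q|P_{U,Q}(0,q)-P_{U,Q}(1,q)|,$$ $$H(U|Q)=-\sum_{q}\sum_u P_{U,Q}(u,q)\log_2\frac{P_{U,Q}(u,q)}{\sum_{u'}P_{U,Q}(u',q)}.$$ For $N=2^n$ let $G_N=B_NG_2^{\otimes n}$ over $\mathbb F_2$, where $G_2=\begin{pmatrix}1&0\\1&1\end{pmatrix}$ and $B_N$ is the $N\times N$ bit-reversal matrix,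 and let $U_1^N=X_1^NG_N$ and $Q_i=(U_1^{i-1},Y_1^N)$ for $1\le i\le N$. For $(U,Q)=(U_i,Q_i)$, the boundary-state-informed parameters are $$Z(U|Q,S_N,S_0)=\sum_{a,b\in\mathcal S}\Pr(S_0=a,S_N=b)\,Z_a^b(U|Q),\qquad K(U|Q,S_N,S_0)=\sum_{a,b\in\mathcal S}\Pr(S_0=a,S_N=b)\,K_a^b(U|Q),$$ where $Z_a^b(U|Q)$, $K_a^b(U|Q)$ are computed from the law of $(U,Q)$ conditioned on $S_0=a,S_N=b$ (pairs $(a,b)$ of probability zero contribute $0$). Let $B_1,B_2,\dots$ be i.i.d. uniform bits on a probability space, and for each $n$ let $i$ be the random index with $i-1=\sum_{j=1}^nB_j2^{n-j}$. Define the random variables $$H_n=H(U_i|Q_i),\quad Z_n=Z(U_i|Q_i),\quad K_n=K(U_i|Q_i),\quad \hat Z_n=Z(U_i|Q_i,S_N,S_0),\quad \hat K_n=K(U_i|Q_i,S_N,S_0).$$ A sequence of $[0,1]$-valued random variables $A_n$ \emph{polarizes} to $A_\infty$ if it converges almost surely to the $\{0,1\}$-valued random variable $A_\infty$. Then the sequence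 $H_n$ polarizes to a random variable $H_\infty$, and: 1. $Z_n$ and $\hat Z_n$ polarize to random variables $Z_\infty$ and $\hat Z_\infty$, respectively, and $Z_\infty=\hat Z_\infty=H_\infty$ almost surely. 2. $K_n$ and $\hat K_n$ polarize to random variables $K_\infty$ and $\hat K_\infty$, respectively, and $K_\infty=\hat K_\infty=1-H_\infty$ almost surely. -/

import Mathlib

open MeasureTheory ProbabilityTheory Filter Topology
open scoped Matrix Kronecker

noncomputable section

namespace Polar

/-! ### Parameters of a joint distribution -/

section Parameters

variable {Ω 𝒬 : Type*} [MeasurableSpace Ω] [Fintype 𝒬]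

/-- The joint distribution `P_{U,Q}(u,q)` of the pair `(U, Q)` under `ν`. -/
def joint (ν : Measure Ω) (U : Ω → ZMod 2) (Q : Ω → 𝒬) (u : ZMod 2) (q : 𝒬) : ℝ :=
  ν.real {ω | U ω = u ∧ Q ω = q}

/-- The Bhattacharyya parameter `Z(U|Q)`. -/
def bhattacharyya (ν : Measure Ω) (U : Ω → ZMod 2) (Q : Ω → 𝒬) : ℝ :=
  2 * ∑ q, Real.sqrt (joint ν U Q 0 q * joint ν U Q 1 q)

/-- The total variation distance `K(U|Q)`. -/
def totalVariation (ν : Measure Ω) (U : Ω → ZMod 2) (Q : Ω → 𝒬) : ℝ :=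
  ∑ q, |joint ν U Q 0 q - joint ν U Q 1 q|

/-- The conditional entropy `H(U|Q)`, in bits, with the usual convention `0 log 0 = 0`. -/
def condEntropy (ν : Measure Ω) (U : Ω → ZMod 2) (Q : Ω → 𝒬) : ℝ :=
  -∑ q, ∑ u, joint ν U Q u q * Real.logb 2 (joint ν U Q u q / ∑ u', joint ν U Q u' q)

end Parameters

/-- The state-informed version of a parameter `T`: the average, over the values `(a, b)` of
the pair of states `(S, S')`, of `T` computed from the law conditioned on `S = a`, `S' = b`.
A pair of values of probability zero contributes zero. -/
def stateInformed {Ω 𝒮 : Type*} [MeasurableSpace Ω] [Fintype 𝒮] (μ : Measure Ω)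
    (S S' : Ω → 𝒮) (T : Measure Ω → ℝ) : ℝ :=
  ∑ a, ∑ b, μ.real {ω | S ω = a ∧ S' ω = b} * T (μ[|{ω | S ω = a ∧ S' ω = b}])

/-! ### Finite-state aperiodic irreducible Markov processes -/

section FAIM

variable {Ω 𝒴 𝒮 : Type*} [MeasurableSpace Ω] [MeasurableSpace 𝒴] [MeasurableSpace 𝒮]

/-- The `N`-step transition probability `P(S_N = b | S_0 = a)` of the state sequence. -/
def transProb (μ : Measure Ω) (S : ℤ → Ω → 𝒮) (N : ℕ) (a b : 𝒮) : ℝ :=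
  (μ[|{ω | S 0 ω = a}]).real {ω | S N ω = b}

/-- `(X_j, Y_j, S_j)`, `j ∈ ℤ`, is a FAIM process (over finite alphabets, `X_j` binary). -/
structure IsFAIM (μ : Measure Ω) (X : ℤ → Ω → ZMod 2) (Y : ℤ → Ω → 𝒴) (S : ℤ → Ω → 𝒮) :
    Prop where
  measurable_X : ∀ j, Measurable (X j)
  measurable_Y : ∀ j, Measurable (Y j)
  measurable_S : ∀ j, Measurable (S j)
  /-- Strict stationarity: the law of the whole process is invariant under time shifts. -/
  stationary : ∀ k : ℤ,
    μ.map (fun ω (j : ℤ) => (X (j + k) ω, Y (j + k) ω, S (j + k) ω)) =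
      μ.map (fun ω (j : ℤ) => (X j ω, Y j ω, S j ω))
  /-- Markov property: given `S_{j-1}`, the variables `X_k, Y_k, S_k` (`k ≥ j`) are jointly
  independent of the variables `X_l, Y_l, S_{l-1}` (`l < j`). -/
  markov : ∀ (j : ℤ) (s : 𝒮),
    IndepFun (fun ω (k : {k : ℤ // j ≤ k}) => (X k ω, Y k ω, S k ω))
      (fun ω (l : {l : ℤ // l < j}) => (X l ω, Y l ω, S (l - 1) ω))
      (μ[|{ω | S (j - 1) ω = s}])
  /-- Every state can be reached from every state. -/
  irreducible : ∀ a b : 𝒮, ∃ N : ℕ, 0 < N ∧ 0 < transProb μ S N a b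
  /-- The only common divisor of the possible return times to a state is `1`. -/
  aperiodic : ∀ (a : 𝒮) (d : ℕ), (∀ N : ℕ, 0 < N → 0 < transProb μ S N a a → d ∣ N) → d = 1

end FAIM

/-! ### The polar transform

Indices `1, …, N = 2^n` are represented by `Fin (2^n)`: the element `i` stands for `i + 1`. -/

/-- The number `(b₁ b₂ ⋯ bₙ)₂`, first digit most significant; `b k` is the digit `b_{k+1}`. -/
def ofDigits (n : ℕ) : (Fin n → Fin 2) ≃ Fin (2 ^ n) :=
  (Equiv.arrowCongr Fin.revPerm (Equiv.refl (Fin 2))).trans finFunctionFinEquiv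

theorem ofDigits_val (n : ℕ) (b : Fin n → Fin 2) :
    (ofDigits n b : ℕ) = ∑ k : Fin n, (b k : ℕ) * 2 ^ (n - 1 - (k : ℕ)) := by
  rw [← Equiv.sum_comp Fin.revPerm]
  simp only [ofDigits, Equiv.trans_apply, finFunctionFinEquiv_apply]
  refine Finset.sum_congr rfl fun k _ => ?_
  have h : n - 1 - (n - (k.val + 1)) = k.val := by omega
  simp [Equiv.arrowCongr, Fin.val_rev, h]

/-- Reversal of the order of the `n` binary digits of an index. -/
def bitReversal (n : ℕ) : Equiv.Perm (Fin (2 ^ n)) :=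
  ((ofDigits n).symm.trans (Equiv.arrowCongr Fin.revPerm (Equiv.refl (Fin 2)))).trans (ofDigits n)

/-- The kernel `G₂`. -/
def G₂ : Matrix (Fin 2) (Fin 2) (ZMod 2) := !![1, 0; 1, 1]

/-- The Kronecker power `G₂^{⊗ n}`. -/
def kronPow : (n : ℕ) → Matrix (Fin (2 ^ n)) (Fin (2 ^ n)) (ZMod 2)
  | 0 => 1
  | n + 1 =>
    let e : Fin 2 × Fin (2 ^ n) ≃ Fin (2 ^ (n + 1)) :=
      finProdFinEquiv.trans (finCongr (pow_succ' 2 n).symm)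
    Matrix.reindex e e (G₂ ⊗ₖ kronPow n)

/-- Arıkan's polarization matrix `G_N = B_N G₂^{⊗ n}`, `N = 2^n`. -/
def polarMatrix (n : ℕ) : Matrix (Fin (2 ^ n)) (Fin (2 ^ n)) (ZMod 2) :=
  (bitReversal n).permMatrix (ZMod 2) * kronPow n

section Transform

variable {Ω 𝒴 : Type*}

/-- `U_1^N = X_1^N G_N`. -/
def polarU (X : ℤ → Ω → ZMod 2) (n : ℕ) (ω : Ω) : Fin (2 ^ n) → ZMod 2 :=
  (fun k : Fin (2 ^ n) => X ((k : ℤ) + 1) ω) ᵥ* polarMatrix n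

/-- `Q_i = (U_1^{i-1}, Y_1^N)`. -/
def polarQ (X : ℤ → Ω → ZMod 2) (Y : ℤ → Ω → 𝒴) (n : ℕ) (i : Fin (2 ^ n)) (ω : Ω) :
    ({k : Fin (2 ^ n) // k < i} → ZMod 2) × (Fin (2 ^ n) → 𝒴) :=
  (fun k => polarU X n ω k, fun k => Y ((k : ℤ) + 1) ω)

end Transform

/-! ### The polarization processes -/

/-- `B 0, B 1, …` are i.i.d. uniform bits; `B j` stands for `B_{j+1}`. -/
structure IsFairBits {Ω' : Type*} [MeasurableSpace Ω'] (P : Measure Ω') (B : ℕ → Ω' → Fin 2) :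
    Prop where
  measurable : ∀ j, Measurable (B j)
  indep : iIndepFun B P
  uniform : ∀ j b, P {ω | B j ω = b} = 1 / 2

/-- The index `i` with `i - 1 = (B_1 ⋯ B_n)₂`. -/
def randIndex {Ω' : Type*} (B : ℕ → Ω' → Fin 2) (n : ℕ) (ω : Ω') : Fin (2 ^ n) :=
  ofDigits n fun j => B j ω

section Processes

variable {Ω Ω' 𝒴 𝒮 : Type*} [MeasurableSpace Ω] [Fintype 𝒴] [Fintype 𝒮]

/-- The conditional entropy process `H_n = H(U_i|Q_i)`. -/
def Hproc (μ : Measure Ω) (X : ℤ → Ω → ZMod 2) (Y : ℤ → Ω → 𝒴) (B : ℕ → Ω' → Fin 2)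
    (n : ℕ) (ω' : Ω') : ℝ :=
  let i := randIndex B n ω'
  condEntropy μ (fun ω => polarU X n ω i) (polarQ X Y n i)

/-- The Bhattacharyya process `Z_n = Z(U_i|Q_i)`. -/
def Zproc (μ : Measure Ω) (X : ℤ → Ω → ZMod 2) (Y : ℤ → Ω → 𝒴) (B : ℕ → Ω' → Fin 2)
    (n : ℕ) (ω' : Ω') : ℝ :=
  let i := randIndex B n ω'
  bhattacharyya μ (fun ω => polarU X n ω i) (polarQ X Y n i)

/-- The total variation distance process `K_n = K(U_i|Q_i)`. -/
def Kproc (μ : Measure Ω) (X : ℤ → Ω → ZMod 2) (Y : ℤ → Ω → 𝒴) (B : ℕ → Ω' → Fin 2)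
    (n : ℕ) (ω' : Ω') : ℝ :=
  let i := randIndex B n ω'
  totalVariation μ (fun ω => polarU X n ω i) (polarQ X Y n i)

/-- The boundary-state-informed Bhattacharyya process `Ẑ_n = Z(U_i|Q_i, S_N, S_0)`. -/
def Zhat (μ : Measure Ω) (X : ℤ → Ω → ZMod 2) (Y : ℤ → Ω → 𝒴) (S : ℤ → Ω → 𝒮)
    (B : ℕ → Ω' → Fin 2) (n : ℕ) (ω' : Ω') : ℝ :=
  let i := randIndex B n ω'
  stateInformed μ (S 0) (S (2 ^ n)) fun ν =>
    bhattacharyya ν (fun ω => polarU X n ω i) (polarQ X Y n i)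

/-- The boundary-state-informed total variation process `K̂_n = K(U_i|Q_i, S_N, S_0)`. -/
def Khat (μ : Measure Ω) (X : ℤ → Ω → ZMod 2) (Y : ℤ → Ω → 𝒴) (S : ℤ → Ω → 𝒮)
    (B : ℕ → Ω' → Fin 2) (n : ℕ) (ω' : Ω') : ℝ :=
  let i := randIndex B n ω'
  stateInformed μ (S 0) (S (2 ^ n)) fun ν =>
    totalVariation ν (fun ω => polarU X n ω i) (polarQ X Y n i)

end Processes

/-- The `[0,1]`-valued random variables `A_n` polarize to `A∞`: they converge almost surely
to the `{0,1}`-valued random variable `A∞`. -/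
structure PolarizesTo {Ω' : Type*} [MeasurableSpace Ω'] (P : Measure Ω') (A : ℕ → Ω' → ℝ)
    (Ainf : Ω' → ℝ) : Prop where
  measurable : ∀ n, Measurable (A n)
  mem_Icc : ∀ n ω, A n ω ∈ Set.Icc (0 : ℝ) 1
  measurable_lim : Measurable Ainf
  lim_eq : ∀ ω, Ainf ω = 0 ∨ Ainf ω = 1
  tendsto : ∀ᵐ ω ∂P, Tendsto (fun n => A n ω) atTop (𝓝 (Ainf ω))

end Polar

end

/-!
Polarization is proved for the conditional entropies, and passed on to the other parameters by
compactness.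

Every parameter is an average over the side information `q` of a function of the posterior
probability of `1`: the binary entropy for `H`, the function `2 √(p (1 - p))` for `Z` and
`|1 - 2 p|` for `K`. A state-informed parameter is the same average for the side information
enlarged by the two boundary states (`stateInformed_posteriorAvg`). The functions for `H`, `Z` and
`1 - K` vanish exactly at deterministic bits and equal `1` exactly at uniform ones, so that by
compactness of `[0, 1]` each average is close to `0`, or to `1`, whenever the entropy is
(`exists_posteriorAvg_le`). It remains to show that `H_n` and its state-informed version `Ĥ_n`
converge almost surely to a common `{0, 1}`-valued limit (`IsFAIM.exists_entropy_limit`).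

By the chain rule and stationarity, the two descendants of an index have on average at most the
entropy of the index, so `H_n` is a bounded supermartingale and converges. Again by the chain rule,
the differences `H_n - Ĥ_n ≥ 0`, summed over all indices, are the information that the boundary
states give about the whole transformed block. It is bounded by a constant that does not depend on
`n`; hence the expectation of `H_n - Ĥ_n` is `O(2⁻ⁿ)`, and `Ĥ_n` has the same limit as `H_n`
(`IsFAIM.sum_indexEntropy_sub_le`).

Finally, two adjacent blocks are independent given the three states at their ends, so the posterior
of the sum of their bits is the convolution of the posteriors `p` and `r` of the two bits. By
strict concavity of the entropy `h`, the gain `2 h(p * r) - h(p) - h(r)` vanishes only if both bits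
are deterministic or both are uniform, so it controls `h(p) (1 - h(r))`
(`exists_entropy_gain`). As all pairs of boundary states have a probability bounded away from zero
for long blocks (`IsFAIM.exists_le_statePair`), this rules out also that the entropy is small for
some boundary states and large for others (`entropy_gain_of_blocks`). Therefore the entropy of a
first descendant exceeds `Ĥ_n` by a definite amount unless `Ĥ_n (1 - Ĥ_n)` is small
(`IsFAIM.exists_entropy_gain`). Almost surely infinitely many steps lead to a first descendant, so
the limit `L` of both sequences satisfies `L (1 - L) = 0`.
-/

namespace Polar

/-! ### Functionals of the posterior distribution -/

/-- The perspective `(a + b) φ(b / (a + b))` of `φ`; for `a = P(0,q)`, `b = P(1,q)` it is the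
contribution of `q` to the average of `φ` over the posterior probability of `1`. -/
noncomputable def persp (φ : ℝ → ℝ) (a b : ℝ) : ℝ := (a + b) * φ (b / (a + b))

/-- The average of `φ(P(1|q))` over `q`, for a joint distribution `J = P_{U,Q}`. All three of
`H(U|Q)`, `Z(U|Q)` and `K(U|Q)` have this form. -/
noncomputable def posteriorAvg {𝒬 : Type*} [Fintype 𝒬] (φ : ℝ → ℝ) (J : ZMod 2 → 𝒬 → ℝ) : ℝ :=
  ∑ q, persp φ (J 0 q) (J 1 q)

/-- The binary entropy function, in bits. -/
noncomputable def hFun (p : ℝ) : ℝ := Real.binEntropy p / Real.log 2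

/-- The function of the posterior that averages to the Bhattacharyya parameter. -/
noncomputable def zFun (p : ℝ) : ℝ := 2 * Real.sqrt (p * (1 - p))

/-- The function of the posterior that averages to the total variation distance. -/
noncomputable def kFun (p : ℝ) : ℝ := |1 - 2 * p|

theorem sum_zmod_two {M : Type*} [AddCommMonoid M] (f : ZMod 2 → M) : ∑ u, f u = f 0 + f 1 :=
  Fin.sum_univ_two f

theorem posterior_mem_Icc {a b : ℝ} (ha : 0 ≤ a) (hb : 0 ≤ b) :
    b / (a + b) ∈ Set.Icc (0 : ℝ) 1 :=
  ⟨div_nonneg hb (add_nonneg ha hb), div_le_one_of_le₀ (by linarith) (add_nonneg ha hb)⟩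

theorem persp_smul (φ : ℝ → ℝ) (c a b : ℝ) : persp φ (c * a) (c * b) = c * persp φ a b := by
  rcases eq_or_ne c 0 with rfl | hc
  · simp [persp]
  · rw [persp, persp, ← mul_add, mul_div_mul_left _ _ hc, mul_assoc]

theorem persp_zFun {a b : ℝ} (ha : 0 ≤ a) (hb : 0 ≤ b) :
    persp zFun a b = 2 * Real.sqrt (a * b) := by
  rcases (add_nonneg ha hb).eq_or_lt with h | h
  · have hb0 : b = 0 := by linarith
    have ha0 : a = 0 := by linarith
    simp [persp, ha0, hb0]
  · have : a * b = (a + b) ^ 2 * (b / (a + b) * (1 - b / (a + b))) := by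
      field_simp
      ring
    rw [this, Real.sqrt_mul (by positivity), Real.sqrt_sq h.le, persp, zFun]
    ring

theorem persp_kFun {a b : ℝ} (ha : 0 ≤ a) (hb : 0 ≤ b) : persp kFun a b = |a - b| := by
  rcases (add_nonneg ha hb).eq_or_lt with h | h
  · have hb0 : b = 0 := by linarith
    have ha0 : a = 0 := by linarith
    simp [persp, ha0, hb0]
  · rw [persp, kFun]
    nth_rw 1 [← abs_of_pos h]
    rw [← abs_mul]
    congr 1
    field_simp
    ring

theorem persp_hFun {a b : ℝ} (ha : 0 ≤ a) (hb : 0 ≤ b) :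
    persp hFun a b =
      (Real.negMulLog a + Real.negMulLog b - Real.negMulLog (a + b)) / Real.log 2 := by
  rcases (add_nonneg ha hb).eq_or_lt with h | h
  · have hb0 : b = 0 := by linarith
    have ha0 : a = 0 := by linarith
    simp [persp, ha0, hb0]
  · rw [persp, hFun, ← mul_div_assoc]
    congr 1
    have h1 : 1 - b / (a + b) = a / (a + b) := by field_simp; ring
    rw [Real.binEntropy_eq_negMulLog_add_negMulLog_one_sub, h1]
    -- `(a + b) * negMulLog (x / (a + b)) = negMulLog x + x * log (a + b)`
    have key : ∀ x : ℝ, 0 ≤ x → (a + b) * Real.negMulLog (x / (a + b)) =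
        Real.negMulLog x + x * Real.log (a + b) := by
      intro x hx
      rcases hx.eq_or_lt with rfl | hx
      · simp
      · rw [Real.negMulLog, Real.log_div hx.ne' h.ne', Real.negMulLog]
        field_simp
        ring
    rw [mul_add, key a ha, key b hb, Real.negMulLog, Real.negMulLog, Real.negMulLog]
    ring

theorem hFun_continuous : Continuous hFun := Real.binEntropy_continuous.div_const _

theorem zFun_continuous : Continuous zFun := by unfold zFun; fun_prop

theorem kFun_continuous : Continuous kFun := by unfold kFun; fun_prop

theorem hFun_nonneg {p : ℝ} (hp : p ∈ Set.Icc (0 : ℝ) 1) : 0 ≤ hFun p :=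
  div_nonneg (Real.binEntropy_nonneg hp.1 hp.2) (Real.log_nonneg one_le_two)

theorem hFun_le_one (p : ℝ) : hFun p ≤ 1 :=
  div_le_one_of_le₀ Real.binEntropy_le_log_two (Real.log_nonneg one_le_two)

theorem hFun_eq_zero {p : ℝ} : hFun p = 0 ↔ p = 0 ∨ p = 1 := by
  rw [hFun, div_eq_zero_iff, or_iff_left (Real.log_pos one_lt_two).ne', Real.binEntropy_eq_zero]

theorem hFun_eq_one {p : ℝ} : hFun p = 1 ↔ p = 2⁻¹ := by
  rw [hFun, div_eq_one_iff_eq (Real.log_pos one_lt_two).ne', Real.binEntropy_eq_log_two]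

theorem hFun_one_sub (p : ℝ) : hFun (1 - p) = hFun p := by simp [hFun]

theorem hFun_strictConcaveOn : StrictConcaveOn ℝ (Set.Icc 0 1) hFun := by
  have hl := Real.log_pos one_lt_two
  refine ⟨convex_Icc 0 1, fun x hx y hy hxy a b ha hb hab => ?_⟩
  have := Real.strictConcave_binEntropy.2 hx hy hxy ha hb hab
  simp only [smul_eq_mul, hFun] at this ⊢
  rw [mul_div_assoc', mul_div_assoc', ← add_div]
  exact div_lt_div_of_pos_right this hl

theorem zFun_nonneg (p : ℝ) : 0 ≤ zFun p := by unfold zFun; positivity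

theorem zFun_le_one (p : ℝ) : zFun p ≤ 1 := by
  have : Real.sqrt (p * (1 - p)) ≤ 1 / 2 := by
    rw [Real.sqrt_le_left (by norm_num)]
    nlinarith [sq_nonneg (p - 1 / 2)]
  unfold zFun
  linarith

theorem kFun_nonneg (p : ℝ) : 0 ≤ kFun p := abs_nonneg _

theorem kFun_le_one {p : ℝ} (hp : p ∈ Set.Icc (0 : ℝ) 1) : kFun p ≤ 1 :=
  abs_le.2 ⟨by linarith [hp.2], by linarith [hp.1]⟩

/-! ### Comparison of continuous functions on a compact set -/

/-- If `g ≤ 0` at the zeros of `f ≥ 0`, then `g` is small wherever `f` is, uniformly on a compact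
set, and linearly in `f` up to an arbitrarily small error. -/
theorem exists_le_add_mul_of_isCompact {α : Type*} [TopologicalSpace α] {s : Set α}
    (hs : IsCompact s) {f g : α → ℝ} (hf : Continuous f) (hg : Continuous g)
    (hf0 : ∀ x ∈ s, 0 ≤ f x) (h : ∀ x ∈ s, f x = 0 → g x ≤ 0) {ε : ℝ} (hε : 0 < ε) :
    ∃ C : ℝ, 0 ≤ C ∧ ∀ x ∈ s, g x ≤ ε + C * f x := by
  set t := s ∩ {x | ε ≤ g x} with ht
  have htc : IsCompact t := hs.inter_right (isClosed_le continuous_const hg)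
  rcases t.eq_empty_or_nonempty with he | hne
  · refine ⟨0, le_rfl, fun x hx => ?_⟩
    by_contra! hlt
    have : x ∈ t := ⟨hx, by simp only [Set.mem_ofPred_eq]; linarith⟩
    simp [he] at this
  · obtain ⟨x₀, hx₀, hmin⟩ := htc.exists_isMinOn hne hf.continuousOn
    obtain ⟨x₁, hx₁, hmax⟩ := htc.exists_isMaxOn hne hg.continuousOn
    have hm : 0 < f x₀ := by
      refine lt_of_le_of_ne (hf0 _ hx₀.1) fun h0 => ?_
      have h1 := h _ hx₀.1 h0.symm
      have h2 : ε ≤ g x₀ := hx₀.2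
      linarith
    have hM : ε ≤ g x₁ := hx₁.2
    refine ⟨g x₁ / f x₀, div_nonneg (by linarith) hm.le, fun x hx => ?_⟩
    by_cases hxt : x ∈ t
    · have h1 : g x ≤ g x₁ := hmax hxt
      have h2 : f x₀ ≤ f x := hmin hxt
      have h3 : g x₁ ≤ g x₁ / f x₀ * f x := by
        rw [div_mul_eq_mul_div, le_div_iff₀ hm]
        exact mul_le_mul_of_nonneg_left h2 (by linarith)
      linarith
    · have h1 : g x < ε := by
        by_contra! hlt
        exact hxt ⟨hx, hlt⟩
      have := mul_nonneg (div_nonneg (by linarith : 0 ≤ g x₁) hm.le) (hf0 x hx)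
      linarith

/-- Convolution of two Bernoulli parameters: the parameter of a sum modulo `2` of independent
bits. -/
def binConv (p r : ℝ) : ℝ := p * (1 - r) + (1 - p) * r

theorem binConv_comm (p r : ℝ) : binConv p r = binConv r p := by unfold binConv; ring

/-- Adding an independent bit does not decrease the entropy, and increases it strictly unless the
added bit is deterministic or the original one is uniform. -/
theorem hFun_binConv {p r : ℝ} (hp : p ∈ Set.Icc (0 : ℝ) 1) (hr : r ∈ Set.Icc (0 : ℝ) 1) :
    hFun p ≤ hFun (binConv p r) ∧
      (hFun (binConv p r) = hFun p → p = 2⁻¹ ∨ r = 0 ∨ r = 1) := by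
  have hp' : 1 - p ∈ Set.Icc (0 : ℝ) 1 := ⟨by linarith [hp.2], by linarith [hp.1]⟩
  have e : binConv p r = (1 - r) • p + r • (1 - p) := by
    simp only [binConv, smul_eq_mul]; ring
  have e' : hFun p = (1 - r) • hFun p + r • hFun (1 - p) := by
    rw [hFun_one_sub, smul_eq_mul, smul_eq_mul]; ring
  constructor
  · rw [e]
    nth_rw 1 [e']
    exact hFun_strictConcaveOn.concaveOn.2 hp hp' (by linarith [hr.2]) hr.1 (by ring)
  · intro heq
    by_contra! hcon
    obtain ⟨h1, h2, h3⟩ := hcon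
    have hlt := hFun_strictConcaveOn.2 hp hp' (fun h => h1 (by linarith))
      (sub_pos.2 (lt_of_le_of_ne hr.2 h3)) (lt_of_le_of_ne hr.1 (Ne.symm h2)) (by ring)
    rw [← e, ← e', heq] at hlt
    exact lt_irrefl _ hlt

/-- The quantitative single-letter form of polarization: the gain in entropy under addition of
independent bits is bounded below unless both bits are almost deterministic or both are almost
uniform. -/
theorem exists_entropy_gain {ε : ℝ} (hε : 0 < ε) :
    ∃ C : ℝ, 0 ≤ C ∧ ∀ p ∈ Set.Icc (0 : ℝ) 1, ∀ r ∈ Set.Icc (0 : ℝ) 1,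
      hFun p * (1 - hFun r) ≤ ε + C * (2 * hFun (binConv p r) - hFun p - hFun r) := by
  have hh := hFun_continuous
  obtain ⟨C, hC, H⟩ := exists_le_add_mul_of_isCompact
    (isCompact_Icc.prod isCompact_Icc : IsCompact (Set.Icc (0 : ℝ) 1 ×ˢ Set.Icc (0 : ℝ) 1))
    (f := fun x => 2 * hFun (binConv x.1 x.2) - hFun x.1 - hFun x.2)
    (g := fun x => hFun x.1 * (1 - hFun x.2)) (by unfold binConv; fun_prop) (by fun_prop)
    (fun x hx => by
      have h1 := (hFun_binConv hx.1 hx.2).1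
      have h2 := (hFun_binConv hx.2 hx.1).1
      rw [binConv_comm] at h2
      linarith)
    (fun x hx h0 => by
      have h1 := hFun_binConv hx.1 hx.2
      have h2 := hFun_binConv hx.2 hx.1
      rw [binConv_comm x.2] at h2
      have h1' := h1.2 (by linarith [h1.1, h2.1])
      have h2' := h2.2 (by linarith [h1.1, h2.1])
      rcases h1' with h | h
      · rcases h2' with h' | h'
        · simp [hFun_eq_one.2 h']
        · simp [hFun_eq_zero.2 h']
      · have : hFun x.2 = 0 := hFun_eq_zero.2 h
        rcases h2' with h' | h'
        · rw [h'] at h; norm_num at h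
        · simp [hFun_eq_zero.2 h']) hε
  exact ⟨C, hC, fun p hp r hr => H (p, r) ⟨hp, hr⟩⟩

/-! ### Averages over the posterior -/

section PosteriorAvg

variable {𝒬 : Type*} [Fintype 𝒬] {J : ZMod 2 → 𝒬 → ℝ}

theorem posteriorAvg_le_add_mul {f g : ℝ → ℝ} {a c : ℝ} (hJ : ∀ u q, 0 ≤ J u q)
    (hJ1 : ∑ q, (J 0 q + J 1 q) = 1) (h : ∀ p ∈ Set.Icc (0 : ℝ) 1, g p ≤ a + c * f p) :
    posteriorAvg g J ≤ a + c * posteriorAvg f J := by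
  have : a + c * posteriorAvg f J =
      ∑ q, (J 0 q + J 1 q) * (a + c * f (J 1 q / (J 0 q + J 1 q))) := by
    simp only [posteriorAvg, persp, mul_add, Finset.sum_add_distrib, ← Finset.sum_mul, hJ1,
      one_mul, Finset.mul_sum]
    congr 1
    exact Finset.sum_congr rfl fun _ _ => by ring
  rw [this]
  exact Finset.sum_le_sum fun q _ => mul_le_mul_of_nonneg_left
    (h _ (posterior_mem_Icc (hJ 0 q) (hJ 1 q))) (add_nonneg (hJ 0 q) (hJ 1 q))

theorem posteriorAvg_one_sub {f : ℝ → ℝ} (hJ1 : ∑ q, (J 0 q + J 1 q) = 1) :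
    posteriorAvg (fun p => 1 - f p) J = 1 - posteriorAvg f J := by
  nth_rw 2 [← hJ1]
  rw [posteriorAvg, posteriorAvg, ← Finset.sum_sub_distrib]
  refine Finset.sum_congr rfl fun _ _ => ?_
  simp only [persp]
  rw [mul_sub, mul_one]

theorem posteriorAvg_mem_Icc {f : ℝ → ℝ} (hJ : ∀ u q, 0 ≤ J u q)
    (hJ1 : ∑ q, (J 0 q + J 1 q) = 1) (hf : ∀ p ∈ Set.Icc (0 : ℝ) 1, f p ∈ Set.Icc (0 : ℝ) 1) :
    posteriorAvg f J ∈ Set.Icc (0 : ℝ) 1 := by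
  constructor
  · exact Finset.sum_nonneg fun q _ => mul_nonneg (add_nonneg (hJ 0 q) (hJ 1 q))
      (hf _ (posterior_mem_Icc (hJ 0 q) (hJ 1 q))).1
  · simpa using posteriorAvg_le_add_mul (f := f) (a := 1) (c := 0) hJ hJ1
      (fun p hp => by simpa using (hf p hp).2)

/-- Perspectives of concave functions are superadditive. -/
theorem persp_add_le {φ : ℝ → ℝ} (hφ : ConcaveOn ℝ (Set.Icc 0 1) φ) {a b a' b' : ℝ}
    (ha : 0 ≤ a) (hb : 0 ≤ b) (ha' : 0 ≤ a') (hb' : 0 ≤ b') :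
    persp φ a b + persp φ a' b' ≤ persp φ (a + a') (b + b') := by
  rcases (add_nonneg ha hb).eq_or_lt with h | h
  · have hb0 : b = 0 := by linarith
    have ha0 : a = 0 := by linarith
    simp [persp, ha0, hb0]
  rcases (add_nonneg ha' hb').eq_or_lt with h' | h'
  · have hb0 : b' = 0 := by linarith
    have ha0 : a' = 0 := by linarith
    simp [persp, ha0, hb0]
  have hs : 0 < a + a' + (b + b') := by linarith
  have h1 : 0 ≤ (a + b) / (a + a' + (b + b')) := by positivity
  have h2 : 0 ≤ (a' + b') / (a + a' + (b + b')) := by positivity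
  have := hφ.2 (posterior_mem_Icc ha hb) (posterior_mem_Icc ha' hb') h1 h2
    (by field_simp; ring)
  simp only [smul_eq_mul] at this
  have e : (a + b) / (a + a' + (b + b')) * (b / (a + b)) +
      (a' + b') / (a + a' + (b + b')) * (b' / (a' + b')) = (b + b') / (a + a' + (b + b')) := by
    field_simp
  rw [e] at this
  have := mul_le_mul_of_nonneg_left this hs.le
  simp only [persp]
  refine le_trans (le_of_eq ?_) this
  field_simp

theorem sum_persp_le {ι : Type*} {φ : ℝ → ℝ} (hφ : ConcaveOn ℝ (Set.Icc 0 1) φ) (s : Finset ι)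
    {f g : ι → ℝ} (hf : ∀ i, 0 ≤ f i) (hg : ∀ i, 0 ≤ g i) :
    ∑ i ∈ s, persp φ (f i) (g i) ≤ persp φ (∑ i ∈ s, f i) (∑ i ∈ s, g i) := by
  classical
  induction s using Finset.induction_on with
  | empty => simp [persp]
  | insert i s hi ih =>
    rw [Finset.sum_insert hi, Finset.sum_insert hi, Finset.sum_insert hi]
    exact (add_le_add_right ih _).trans (persp_add_le hφ (hf i) (hg i)
      (Finset.sum_nonneg fun _ _ => hf _) (Finset.sum_nonneg fun _ _ => hg _))

end PosteriorAvg

/-! ### Random variables with finitely many values -/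

section FiniteValued

/-- `A` is measurable for the discrete σ-algebra on its codomain. For maps to a finite type this
is preserved by pairing and by arbitrary functions, whatever σ-algebra the codomain carries. -/
def DiscreteMeasurable {Ω α : Type*} [MeasurableSpace Ω] (A : Ω → α) : Prop :=
  ∀ s : Set α, MeasurableSet (A ⁻¹' s)

variable {Ω α β : Type*} [MeasurableSpace Ω]

theorem DiscreteMeasurable.comp {A : Ω → α} (hA : DiscreteMeasurable A) (f : α → β) :
    DiscreteMeasurable fun ω => f (A ω) := fun s => hA (f ⁻¹' s)

theorem discreteMeasurable_of_singleton [Finite α] {A : Ω → α}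
    (h : ∀ a, MeasurableSet (A ⁻¹' {a})) : DiscreteMeasurable A := fun s => by
  rw [← Set.biUnion_of_singleton s, Set.preimage_iUnion₂]
  exact MeasurableSet.biUnion s.to_countable fun a _ => h a

theorem _root_.Measurable.discreteMeasurable [MeasurableSpace α] [MeasurableSingletonClass α]
    [Finite α] {A : Ω → α} (h : Measurable A) : DiscreteMeasurable A :=
  discreteMeasurable_of_singleton fun a => h (measurableSet_singleton a)

theorem DiscreteMeasurable.prodMk [Finite α] [Finite β] {A : Ω → α} {B : Ω → β}
    (hA : DiscreteMeasurable A) (hB : DiscreteMeasurable B) :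
    DiscreteMeasurable fun ω => (A ω, B ω) :=
  discreteMeasurable_of_singleton fun p => by
    have : (fun ω => (A ω, B ω)) ⁻¹' {p} = A ⁻¹' {p.1} ∩ B ⁻¹' {p.2} := by
      ext ω; simp [Prod.ext_iff]
    rw [this]
    exact (hA _).inter (hB _)

theorem DiscreteMeasurable.pi {ι : Type*} [Finite ι] [Finite α] {A : ι → Ω → α}
    (hA : ∀ i, DiscreteMeasurable (A i)) : DiscreteMeasurable fun ω i => A i ω :=
  discreteMeasurable_of_singleton fun f => by
    have : (fun ω i => A i ω) ⁻¹' {f} = ⋂ i, A i ⁻¹' {f i} := by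
      ext ω; simp [funext_iff]
    rw [this]
    exact MeasurableSet.iInter fun i => hA i _

variable {μ : Measure Ω} [IsProbabilityMeasure μ]

/-- Marginalization. -/
theorem measureReal_preimage_comp [Fintype α] [DecidableEq β] {A : Ω → α}
    (hA : DiscreteMeasurable A) (f : α → β) (b : β) :
    μ.real ((fun ω => f (A ω)) ⁻¹' {b}) = ∑ a with f a = b, μ.real (A ⁻¹' {a}) := by
  rw [← measureReal_biUnion_finset]
  · congr 1
    ext ω
    simp
  · intro a _ a' _ h
    exact Disjoint.preimage _ (Set.disjoint_singleton.2 h)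
  · exact fun a _ => hA _

theorem sum_measureReal_preimage [Fintype α] {A : Ω → α} (hA : DiscreteMeasurable A) :
    ∑ a, μ.real (A ⁻¹' {a}) = 1 := by
  have := measureReal_preimage_comp (μ := μ) hA (fun _ => ()) ()
  simpa using this.symm

theorem sum_measureReal_preimage_prodMk [Fintype α] [Fintype β] {A : Ω → α} {B : Ω → β}
    (hA : DiscreteMeasurable A) (hB : DiscreteMeasurable B) (b : β) :
    ∑ a, μ.real ((fun ω => (A ω, B ω)) ⁻¹' {(a, b)}) = μ.real (B ⁻¹' {b}) := by
  classical
  rw [show B = fun ω => Prod.snd (A ω, B ω) from rfl,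
    measureReal_preimage_comp (hA.prodMk hB) Prod.snd b]
  symm
  refine Finset.sum_bij' (fun p _ => p.1) (fun a _ => (a, b)) ?_ ?_ ?_ ?_ ?_ <;> simp +contextual

end FiniteValued

/-! ### Shannon entropy -/

section Entropy

variable {Ω α β : Type*} [MeasurableSpace Ω] [Fintype α] [Fintype β]

/-- The Shannon entropy, in nats, of a random variable with finitely many values. -/
noncomputable def entropy (μ : Measure Ω) (A : Ω → α) : ℝ :=
  ∑ a, Real.negMulLog (μ.real (A ⁻¹' {a}))

/-- Splitting a mass into parts increases its contribution to the entropy, by at most the total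
mass times the number of parts. -/
theorem negMulLog_sum_bounds {ι : Type*} (s : Finset ι) {f : ι → ℝ} (hf : ∀ i, 0 ≤ f i) :
    Real.negMulLog (∑ i ∈ s, f i) ≤ ∑ i ∈ s, Real.negMulLog (f i) ∧
      ∑ i ∈ s, Real.negMulLog (f i) ≤
        Real.negMulLog (∑ i ∈ s, f i) + (∑ i ∈ s, f i) * s.card := by
  set t := ∑ i ∈ s, f i with ht
  have e : Real.negMulLog t = ∑ i ∈ s, f i * -Real.log t := by
    rw [← Finset.sum_mul, Real.negMulLog]; ring
  have hle : ∀ i ∈ s, f i ≤ t := fun i hi => Finset.single_le_sum (fun j _ => hf j) hi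
  have e' : t * s.card = ∑ i ∈ s, t := by simp [mul_comm]
  rw [e, e', ← Finset.sum_add_distrib]
  constructor
  · refine Finset.sum_le_sum fun i hi => ?_
    rcases (hf i).eq_or_lt with h | h
    · simp [← h]
    · have := Real.log_le_log h (hle i hi)
      rw [Real.negMulLog]
      nlinarith
  · refine Finset.sum_le_sum fun i hi => ?_
    rcases (hf i).eq_or_lt with h | h
    · simp [← h, ht ▸ Finset.sum_nonneg fun _ _ => hf _]
    · have h1 : 0 < t := h.trans_le (hle i hi)
      have h2 := Real.log_le_self (div_nonneg h1.le h.le)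
      rw [Real.log_div h1.ne' h.ne'] at h2
      have h3 := mul_le_mul_of_nonneg_left h2 h.le
      rw [mul_div_cancel₀ _ h.ne'] at h3
      rw [Real.negMulLog]
      linarith

variable {μ : Measure Ω} [IsProbabilityMeasure μ]

/-- A function of a random variable has at most its entropy. -/
theorem entropy_le_of_factorsThrough {A : Ω → α} {B : Ω → β} (hB : DiscreteMeasurable B)
    (h : Function.FactorsThrough A B) : entropy μ A ≤ entropy μ B := by
  classical
  have : Nonempty Ω := nonempty_of_isProbabilityMeasure μ
  have : Nonempty α := ⟨A (Classical.arbitrary Ω)⟩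
  obtain ⟨f, rfl⟩ := (Function.factorsThrough_iff _).1 h
  have h1 : entropy μ B = ∑ a, ∑ b with f b = a, Real.negMulLog (μ.real (B ⁻¹' {b})) :=
    (Finset.sum_fiberwise _ _ _).symm
  rw [h1]
  refine Finset.sum_le_sum fun a _ => ?_
  rw [show f ∘ B = fun ω => f (B ω) from rfl, measureReal_preimage_comp hB]
  exact (negMulLog_sum_bounds _ fun _ => measureReal_nonneg).1

theorem entropy_congr {A : Ω → α} {B : Ω → β} (hA : DiscreteMeasurable A)
    (hB : DiscreteMeasurable B) (h : ∀ ω ω', A ω = A ω' ↔ B ω = B ω') :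
    entropy μ A = entropy μ B :=
  le_antisymm (entropy_le_of_factorsThrough hB fun ω ω' h' => (h ω ω').2 h')
    (entropy_le_of_factorsThrough hA fun ω ω' h' => (h ω ω').1 h')

/-- A random variable with values in `α` adds at most a constant depending on `α` to the
entropy. -/
theorem entropy_prodMk_le {A : Ω → α} {B : Ω → β} (hA : DiscreteMeasurable A)
    (hB : DiscreteMeasurable B) :
    entropy μ (fun ω => (A ω, B ω)) ≤ entropy μ B + Fintype.card α := by
  have e : entropy μ (fun ω => (A ω, B ω)) =
      ∑ b, ∑ a, Real.negMulLog (μ.real ((fun ω => (A ω, B ω)) ⁻¹' {(a, b)})) := by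
    rw [entropy, Fintype.sum_prod_type_right]
  have e1 : (Fintype.card α : ℝ) = ∑ b, μ.real (B ⁻¹' {b}) * (Fintype.card α : ℝ) := by
    rw [← Finset.sum_mul, sum_measureReal_preimage hB, one_mul]
  rw [e, e1, entropy, ← Finset.sum_add_distrib]
  refine Finset.sum_le_sum fun b _ => ?_
  rw [← sum_measureReal_preimage_prodMk hA hB b]
  exact (negMulLog_sum_bounds _ fun _ => measureReal_nonneg).2

end Entropy

/-! ### The parameters of a pair as averages over the posterior -/

section Joint

variable {Ω 𝒬 𝒬' : Type*} [MeasurableSpace Ω]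

theorem joint_eq (ν : Measure Ω) (U : Ω → ZMod 2) (Q : Ω → 𝒬) (u : ZMod 2) (q : 𝒬) :
    joint ν U Q u q = ν.real ((fun ω => (U ω, Q ω)) ⁻¹' {(u, q)}) := by
  rw [joint]
  congr 1
  ext ω
  simp

theorem joint_nonneg (ν : Measure Ω) (U : Ω → ZMod 2) (Q : Ω → 𝒬) (u : ZMod 2) (q : 𝒬) :
    0 ≤ joint ν U Q u q := measureReal_nonneg

variable [Fintype 𝒬] [Fintype 𝒬']

theorem bhattacharyya_eq_posteriorAvg (ν : Measure Ω) (U : Ω → ZMod 2) (Q : Ω → 𝒬) :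
    bhattacharyya ν U Q = posteriorAvg zFun (joint ν U Q) := by
  simp only [bhattacharyya, posteriorAvg, Finset.mul_sum,
    persp_zFun (joint_nonneg ν U Q _ _) (joint_nonneg ν U Q _ _)]

theorem totalVariation_eq_posteriorAvg (ν : Measure Ω) (U : Ω → ZMod 2) (Q : Ω → 𝒬) :
    totalVariation ν U Q = posteriorAvg kFun (joint ν U Q) := by
  simp only [totalVariation, posteriorAvg,
    persp_kFun (joint_nonneg ν U Q _ _) (joint_nonneg ν U Q _ _)]

theorem condEntropy_eq_posteriorAvg (ν : Measure Ω) (U : Ω → ZMod 2) (Q : Ω → 𝒬) :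
    condEntropy ν U Q = posteriorAvg hFun (joint ν U Q) := by
  rw [condEntropy, posteriorAvg, ← Finset.sum_neg_distrib]
  refine Finset.sum_congr rfl fun q _ => ?_
  have h0 := joint_nonneg ν U Q 0 q
  have h1 := joint_nonneg ν U Q 1 q
  rw [sum_zmod_two, sum_zmod_two, persp_hFun h0 h1]
  set a := joint ν U Q 0 q
  set b := joint ν U Q 1 q
  have key : ∀ x, 0 ≤ x → x ≤ a + b → x * Real.logb 2 (x / (a + b)) =
      (x * Real.log x - x * Real.log (a + b)) / Real.log 2 := by
    intro x hx hxab
    rcases hx.eq_or_lt with rfl | hx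
    · simp
    · rw [Real.logb, Real.log_div hx.ne' (hx.trans_le hxab).ne']
      ring
  rw [key a h0 (by linarith), key b h1 (by linarith)]
  simp only [Real.negMulLog]
  ring

variable {μ : Measure Ω} [IsProbabilityMeasure μ]

theorem sum_joint {U : Ω → ZMod 2} {Q : Ω → 𝒬} (hU : DiscreteMeasurable U)
    (hQ : DiscreteMeasurable Q) : ∑ q, (joint μ U Q 0 q + joint μ U Q 1 q) = 1 := by
  rw [← sum_measureReal_preimage (μ := μ) (hU.prodMk hQ), Fintype.sum_prod_type_right]
  exact Finset.sum_congr rfl fun q _ => by rw [sum_zmod_two, joint_eq, joint_eq]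

theorem joint_add {U : Ω → ZMod 2} {Q : Ω → 𝒬} (hU : DiscreteMeasurable U)
    (hQ : DiscreteMeasurable Q) (q : 𝒬) :
    joint μ U Q 0 q + joint μ U Q 1 q = μ.real (Q ⁻¹' {q}) := by
  rw [← sum_measureReal_preimage_prodMk hU hQ, sum_zmod_two, joint_eq, joint_eq]

/-- The conditional entropy as a difference of entropies. -/
theorem condEntropy_eq_entropy_sub {U : Ω → ZMod 2} {Q : Ω → 𝒬} (hU : DiscreteMeasurable U)
    (hQ : DiscreteMeasurable Q) :
    condEntropy μ U Q = (entropy μ (fun ω => (U ω, Q ω)) - entropy μ Q) / Real.log 2 := by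
  rw [condEntropy_eq_posteriorAvg, posteriorAvg, entropy, entropy, Fintype.sum_prod_type_right,
    ← Finset.sum_sub_distrib, Finset.sum_div]
  refine Finset.sum_congr rfl fun q _ => ?_
  rw [persp_hFun (joint_nonneg _ _ _ _ _) (joint_nonneg _ _ _ _ _), joint_add hU hQ, sum_zmod_two,
    joint_eq, joint_eq]

/-- Data processing: conditioning on a function of `Q'` in place of `Q'` does not decrease the
entropy. -/
theorem condEntropy_le_of_factorsThrough {U : Ω → ZMod 2} {Q : Ω → 𝒬} {Q' : Ω → 𝒬'}
    (hU : DiscreteMeasurable U) (hQ' : DiscreteMeasurable Q') (h : Function.FactorsThrough Q Q') :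
    condEntropy μ U Q' ≤ condEntropy μ U Q := by
  classical
  have : Nonempty Ω := nonempty_of_isProbabilityMeasure μ
  have : Nonempty 𝒬 := ⟨Q (Classical.arbitrary Ω)⟩
  obtain ⟨f, rfl⟩ := (Function.factorsThrough_iff _).1 h
  rw [condEntropy_eq_posteriorAvg, condEntropy_eq_posteriorAvg, posteriorAvg, posteriorAvg]
  have hJ : ∀ u q, joint μ U (f ∘ Q') u q = ∑ q' with f q' = q, joint μ U Q' u q' := by
    intro u q
    rw [joint_eq]
    simp only [joint_eq]
    have := measureReal_preimage_comp (μ := μ) (hU.prodMk hQ')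
      (fun p : ZMod 2 × 𝒬' => (p.1, f p.2)) (u, q)
    simp only [Function.comp_apply]
    rw [this]
    symm
    refine Finset.sum_bij' (fun q' _ => (u, q')) (fun p _ => p.2) ?_ ?_ ?_ ?_ ?_ <;>
      simp +contextual
  rw [← Finset.sum_fiberwise _ f]
  refine Finset.sum_le_sum fun q _ => ?_
  rw [hJ, hJ]
  exact sum_persp_le hFun_strictConcaveOn.concaveOn _ (fun _ => joint_nonneg _ _ _ _ _)
    (fun _ => joint_nonneg _ _ _ _ _)

theorem measureReal_mul_cond {E : Set Ω} (hE : MeasurableSet E) (F : Set Ω) :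
    μ.real E * (μ[|E]).real F = μ.real (E ∩ F) := by
  rcases eq_or_ne (μ E) 0 with h | h
  · rw [measureReal_def, h, ENNReal.toReal_zero, zero_mul, measureReal_def,
      measure_mono_null Set.inter_subset_left h, ENNReal.toReal_zero]
  · rw [measureReal_def, measureReal_def, measureReal_def, cond_apply hE, ← ENNReal.toReal_mul,
      ← mul_assoc, ENNReal.mul_inv_cancel h (measure_ne_top _ _), one_mul]

/-- A state-informed parameter is the parameter for the side information enlarged by the
states. -/
theorem stateInformed_posteriorAvg {𝒮 : Type*} [Fintype 𝒮] (φ : ℝ → ℝ) {U : Ω → ZMod 2}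
    {Q : Ω → 𝒬} {S S' : Ω → 𝒮} (hS : DiscreteMeasurable S) (hS' : DiscreteMeasurable S') :
    stateInformed μ S S' (fun ν => posteriorAvg φ (joint ν U Q)) =
      posteriorAvg φ (joint μ U fun ω => (Q ω, S ω, S' ω)) := by
  have key : ∀ a b u q, μ.real {ω | S ω = a ∧ S' ω = b} *
      joint (μ[|{ω | S ω = a ∧ S' ω = b}]) U Q u q =
      joint μ U (fun ω => (Q ω, S ω, S' ω)) u (q, a, b) := by
    intro a b u q
    have hE : MeasurableSet {ω | S ω = a ∧ S' ω = b} := (hS {a}).inter (hS' {b})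
    rw [joint, joint, measureReal_mul_cond hE]
    congr 1
    ext ω
    simp only [Set.mem_inter_iff, Set.mem_ofPred_eq, Prod.mk.injEq]
    tauto
  rw [posteriorAvg, Fintype.sum_prod_type_right, Fintype.sum_prod_type, stateInformed]
  refine Finset.sum_congr rfl fun a _ => Finset.sum_congr rfl fun b _ => ?_
  rw [posteriorAvg, Finset.mul_sum]
  refine Finset.sum_congr rfl fun q _ => ?_
  rw [← persp_smul, key, key]

end Joint

/-! ### One step of the polar transform -/

section Recursion

/-- The index `2 i + b` (for indices counted from zero): the two descendants of the index `i`
at the next level. -/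
def child {n : ℕ} (i : Fin (2 ^ n)) (b : Fin 2) : Fin (2 ^ (n + 1)) :=
  ⟨2 * i + b, by have := i.2; have := b.2; rw [pow_succ]; omega⟩

theorem child_surjective {n : ℕ} (k : Fin (2 ^ (n + 1))) : ∃ i b, child (n := n) i b = k := by
  have hk : (k : ℕ) < 2 ^ n * 2 := pow_succ 2 n ▸ k.2
  exact ⟨⟨k / 2, by omega⟩, ⟨k % 2, by omega⟩, Fin.ext (by simp only [child]; omega)⟩

theorem child_inj {n : ℕ} {i i' : Fin (2 ^ n)} {b b' : Fin 2} :
    child i b = child i' b' ↔ i = i' ∧ b = b' := by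
  have := b.2
  have := b'.2
  simp only [child, Fin.ext_iff]
  omega

theorem ofDigits_snoc {n : ℕ} (d : Fin n → Fin 2) (b : Fin 2) :
    ofDigits (n + 1) (Fin.snoc d b : Fin (n + 1) → Fin 2) = child (ofDigits n d) b := by
  apply Fin.ext
  rw [ofDigits_val, Fin.sum_univ_castSucc]
  simp only [child, Fin.snoc_castSucc, Fin.snoc_last, Fin.val_castSucc, Fin.val_last,
    ofDigits_val, Finset.mul_sum]
  congr 1
  · refine Finset.sum_congr rfl fun k _ => ?_
    have : n + 1 - 1 - (k : ℕ) = n - 1 - k + 1 := by have := k.2; omega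
    rw [this, pow_succ]
    ring
  · simp

theorem ofDigits_cons {n : ℕ} (a : Fin 2) (d : Fin n → Fin 2) :
    ofDigits (n + 1) (Fin.cons a d : Fin (n + 1) → Fin 2) =
      finCongr (pow_succ' 2 n).symm (finProdFinEquiv (a, ofDigits n d)) := by
  apply Fin.ext
  rw [ofDigits_val, Fin.sum_univ_succ]
  simp only [Fin.cons_zero, Fin.cons_succ, finCongr_apply, Fin.val_cast, finProdFinEquiv_apply_val,
    ofDigits_val, Fin.val_zero, Fin.val_succ]
  rw [add_comm]
  congr 1
  · refine Finset.sum_congr rfl fun k _ => ?_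
    rw [show n + 1 - 1 - ((k : ℕ) + 1) = n - 1 - k by omega]
  · simp [mul_comm]

theorem bitReversal_ofDigits {n : ℕ} (d : Fin n → Fin 2) :
    bitReversal n (ofDigits n d) = ofDigits n fun k => d (Fin.rev k) := by
  simp [bitReversal, Equiv.arrowCongr]
  rfl

theorem kronPow_ofDigits {n : ℕ} (r c : Fin n → Fin 2) :
    kronPow n (ofDigits n r) (ofDigits n c) = ∏ k, G₂ (r k) (c k) := by
  induction n with
  | zero =>
    rw [Subsingleton.elim r c, kronPow, Matrix.one_apply_eq]
    simp
  | succ n ih =>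
    rw [← Fin.cons_self_tail r, ← Fin.cons_self_tail c, ofDigits_cons, ofDigits_cons,
      Fin.prod_univ_succ]
    simp only [Fin.cons_zero, Fin.cons_succ, ← ih]
    simp [kronPow]

variable {Ω 𝒴 : Type*}

/-- The polar transform in terms of binary digits. -/
theorem polarU_ofDigits (X : ℤ → Ω → ZMod 2) {n : ℕ} (ω : Ω) (c : Fin n → Fin 2) :
    polarU X n ω (ofDigits n c) =
      ∑ d, X (((ofDigits n d : ℕ) : ℤ) + 1) ω * ∏ k, G₂ (d (Fin.rev k)) (c k) := by
  rw [polarU, Matrix.vecMul, dotProduct, ← Equiv.sum_comp (ofDigits n)]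
  refine Finset.sum_congr rfl fun d _ => ?_
  rw [polarMatrix, PEquiv.toMatrix_toPEquiv_mul, Matrix.submatrix_apply, bitReversal_ofDigits,
    id, kronPow_ofDigits]

/-- The process `X` after a block of length `2 ^ n`. -/
def shift {α : Type*} (X : ℤ → Ω → α) (n : ℕ) : ℤ → Ω → α := fun j => X (j + 2 ^ n)

theorem polarU_child (X : ℤ → Ω → ZMod 2) {n : ℕ} (ω : Ω) (i : Fin (2 ^ n)) (b : Fin 2) :
    polarU X (n + 1) ω (child i b) =
      G₂ 0 b * polarU X n ω i + G₂ 1 b * polarU (shift X n) n ω i := by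
  obtain ⟨c, rfl⟩ := (ofDigits n).surjective i
  have hcons : ∀ (a : Fin 2) (d : Fin n → Fin 2),
      (ofDigits (n + 1) (Fin.consEquiv (fun _ => Fin 2) (a, d)) : ℕ) =
        ofDigits n d + 2 ^ n * a := fun a d => by
    rw [show Fin.consEquiv (fun _ => Fin 2) (a, d) = Fin.cons a d from rfl, ofDigits_cons]
    rfl
  have hprod : ∀ (a : Fin 2) (d : Fin n → Fin 2),
      ∏ k, G₂ (Fin.consEquiv (fun _ => Fin 2) (a, d) (Fin.rev k))
        ((Fin.snoc c b : Fin (n + 1) → Fin 2) k) = (∏ k, G₂ (d (Fin.rev k)) (c k)) * G₂ a b :=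
    fun a d => by
      rw [show Fin.consEquiv (fun _ => Fin 2) (a, d) = Fin.cons a d from rfl,
        Fin.prod_univ_castSucc]
      simp only [Fin.rev_castSucc, Fin.rev_last, Fin.cons_succ, Fin.cons_zero,
        Fin.snoc_castSucc, Fin.snoc_last]
  rw [← ofDigits_snoc, polarU_ofDigits, polarU_ofDigits, polarU_ofDigits,
    ← Equiv.sum_comp (Fin.consEquiv fun _ => Fin 2), Fintype.sum_prod_type, Fin.sum_univ_two]
  simp only [hcons, hprod, Finset.mul_sum, shift, Fin.val_zero, Fin.val_one, mul_zero, add_zero,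
    mul_one, Nat.cast_add, Nat.cast_pow, Nat.cast_ofNat]
  congr 1
  · exact Finset.sum_congr rfl fun d _ => by ring
  · refine Finset.sum_congr rfl fun d _ => ?_
    rw [add_right_comm]
    ring

theorem polarU_child_zero (X : ℤ → Ω → ZMod 2) {n : ℕ} (ω : Ω) (i : Fin (2 ^ n)) :
    polarU X (n + 1) ω (child i 0) = polarU X n ω i + polarU (shift X n) n ω i := by
  simp [polarU_child, G₂]

theorem polarU_child_one (X : ℤ → Ω → ZMod 2) {n : ℕ} (ω : Ω) (i : Fin (2 ^ n)) :
    polarU X (n + 1) ω (child i 1) = polarU (shift X n) n ω i := by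
  simp [polarU_child, G₂]

theorem polarU_child_eq_iff (X : ℤ → Ω → ZMod 2) {n : ℕ} (ω ω' : Ω) (i : Fin (2 ^ n)) :
    (∀ b, polarU X (n + 1) ω (child i b) = polarU X (n + 1) ω' (child i b)) ↔
      polarU X n ω i = polarU X n ω' i ∧
        polarU (shift X n) n ω i = polarU (shift X n) n ω' i := by
  rw [Fin.forall_fin_two, polarU_child_zero, polarU_child_zero, polarU_child_one,
    polarU_child_one]
  constructor
  · rintro ⟨h1, h2⟩
    rw [h2] at h1
    exact ⟨add_right_cancel h1, h2⟩
  · rintro ⟨h1, h2⟩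
    rw [h1, h2]
    exact ⟨rfl, rfl⟩

theorem polarQ_eq_iff (X : ℤ → Ω → ZMod 2) (Y : ℤ → Ω → 𝒴) {n : ℕ} (i : Fin (2 ^ n))
    (ω ω' : Ω) : polarQ X Y n i ω = polarQ X Y n i ω' ↔
      (∀ k < i, polarU X n ω k = polarU X n ω' k) ∧
        ∀ k : ℕ, k < 2 ^ n → Y (k + 1) ω = Y (k + 1) ω' := by
  simp [polarQ, Prod.ext_iff, funext_iff, Fin.forall_iff]

/-- The observations of a block of length `2 ^ (n + 1)` are those of its halves. -/
theorem forall_block_iff (Y : ℤ → Ω → 𝒴) (n : ℕ) (ω ω' : Ω) :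
    (∀ k : ℕ, k < 2 ^ (n + 1) → Y (k + 1) ω = Y (k + 1) ω') ↔
      (∀ k : ℕ, k < 2 ^ n → Y (k + 1) ω = Y (k + 1) ω') ∧
        ∀ k : ℕ, k < 2 ^ n → shift Y n (k + 1) ω = shift Y n (k + 1) ω' := by
  have e : ∀ k : ℕ, (k : ℤ) + 1 + 2 ^ n = ((k + 2 ^ n : ℕ) : ℤ) + 1 := by
    intro k; push_cast; ring
  simp only [shift, e, pow_succ]
  constructor
  · exact fun h => ⟨fun k hk => h k (by omega), fun k hk => h _ (by omega)⟩
  · rintro ⟨h1, h2⟩ k hk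
    by_cases hk' : k < 2 ^ n
    · exact h1 k hk'
    · have := h2 (k - 2 ^ n) (by omega)
      rwa [Nat.sub_add_cancel (by omega)] at this

theorem polarQ_child_zero_eq_iff (X : ℤ → Ω → ZMod 2) (Y : ℤ → Ω → 𝒴) {n : ℕ}
    (i : Fin (2 ^ n)) (ω ω' : Ω) :
    polarQ X Y (n + 1) (child i 0) ω = polarQ X Y (n + 1) (child i 0) ω' ↔
      polarQ X Y n i ω = polarQ X Y n i ω' ∧
        polarQ (shift X n) (shift Y n) n i ω = polarQ (shift X n) (shift Y n) n i ω' := by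
  rw [polarQ_eq_iff, polarQ_eq_iff, polarQ_eq_iff, forall_block_iff]
  have : (∀ k < child i 0, polarU X (n + 1) ω k = polarU X (n + 1) ω' k) ↔
      ∀ k < i, polarU X n ω k = polarU X n ω' k ∧
        polarU (shift X n) n ω k = polarU (shift X n) n ω' k := by
    simp only [← polarU_child_eq_iff]
    constructor
    · exact fun h k hk b => h _ (by
        have := b.2; rw [Fin.lt_def] at hk ⊢; simp only [child, Fin.val_zero]; omega)
    · intro h k hk
      obtain ⟨k, b, rfl⟩ := child_surjective k
      exact h k (by rw [Fin.lt_def] at hk ⊢; simp only [child, Fin.val_zero] at hk; omega) b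
  rw [this]
  simp only [forall_and]
  tauto

theorem polarQ_child_one_eq_iff (X : ℤ → Ω → ZMod 2) (Y : ℤ → Ω → 𝒴) {n : ℕ}
    (i : Fin (2 ^ n)) (ω ω' : Ω) :
    polarQ X Y (n + 1) (child i 1) ω = polarQ X Y (n + 1) (child i 1) ω' ↔
      polarQ X Y (n + 1) (child i 0) ω = polarQ X Y (n + 1) (child i 0) ω' ∧
        polarU X (n + 1) ω (child i 0) = polarU X (n + 1) ω' (child i 0) := by
  rw [polarQ_eq_iff, polarQ_eq_iff]
  have : (∀ k < child i 1, polarU X (n + 1) ω k = polarU X (n + 1) ω' k) ↔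
      (∀ k < child i 0, polarU X (n + 1) ω k = polarU X (n + 1) ω' k) ∧
        polarU X (n + 1) ω (child i 0) = polarU X (n + 1) ω' (child i 0) := by
    have e : ∀ k, k < child i 1 ↔ k < child i 0 ∨ k = child i 0 := by
      intro k
      rw [Fin.lt_def, Fin.lt_def, Fin.ext_iff]
      simp only [child, Fin.val_zero, Fin.val_one]
      omega
    simp only [e, or_imp, forall_and, forall_eq]
  rw [this]
  tauto

variable [MeasurableSpace Ω] [Finite 𝒴]

theorem discreteMeasurable_polarU {X : ℤ → Ω → ZMod 2} {n : ℕ}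
    (hX : ∀ k : ℕ, k < 2 ^ n → DiscreteMeasurable (X (k + 1))) :
    DiscreteMeasurable fun ω => polarU X n ω :=
  (DiscreteMeasurable.pi fun k : Fin (2 ^ n) => hX k k.2).comp fun x => x ᵥ* polarMatrix n

theorem discreteMeasurable_polarQ {X : ℤ → Ω → ZMod 2} {Y : ℤ → Ω → 𝒴} {n : ℕ}
    (hX : ∀ k : ℕ, k < 2 ^ n → DiscreteMeasurable (X (k + 1)))
    (hY : ∀ k : ℕ, k < 2 ^ n → DiscreteMeasurable (Y (k + 1))) (i : Fin (2 ^ n)) :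
    DiscreteMeasurable (polarQ X Y n i) :=
  ((discreteMeasurable_polarU hX).comp fun u (k : {k // k < i}) => u k).prodMk
    (DiscreteMeasurable.pi fun k : Fin (2 ^ n) => hY k k.2)

end Recursion

/-! ### Finite-state processes: stationarity, conditional independence and mixing -/

set_option linter.unusedSectionVars false

section Stationary

variable {Ω 𝒴 𝒮 : Type*} [MeasurableSpace Ω]
  [Fintype 𝒴] [MeasurableSpace 𝒴] [MeasurableSingletonClass 𝒴]
  [Fintype 𝒮] [MeasurableSpace 𝒮] [MeasurableSingletonClass 𝒮]
  {μ : Measure Ω} {X : ℤ → Ω → ZMod 2} {Y : ℤ → Ω → 𝒴} {S : ℤ → Ω → 𝒮}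

theorem IsFAIM.measureReal_shift (h : IsFAIM μ X Y S) {α : Type*}
    {A : (ℤ → ZMod 2 × 𝒴 × 𝒮) → α} (hA : DiscreteMeasurable A) (k : ℤ) (a : α) :
    μ.real ((fun ω => A fun j => (X (j + k) ω, Y (j + k) ω, S (j + k) ω)) ⁻¹' {a}) =
      μ.real ((fun ω => A fun j => (X j ω, Y j ω, S j ω)) ⁻¹' {a}) := by
  have hm : ∀ k : ℤ, Measurable fun ω (j : ℤ) => (X (j + k) ω, Y (j + k) ω, S (j + k) ω) :=
    fun k => measurable_pi_lambda _ fun j =>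
      (h.measurable_X _).prodMk ((h.measurable_Y _).prodMk (h.measurable_S _))
  have hm0 : Measurable fun ω (j : ℤ) => (X j ω, Y j ω, S j ω) := by simpa using hm 0
  have := congrArg (fun ν => ν (A ⁻¹' {a})) (h.stationary k)
  simp only [Measure.map_apply (hm k) (hA _), Measure.map_apply hm0 (hA _)] at this
  exact congrArg ENNReal.toReal this

/-- The events depending on `X_l, Y_l, S_{l-1}` for `l < j`. -/
abbrev pastAlgebra (X : ℤ → Ω → ZMod 2) (Y : ℤ → Ω → 𝒴) (S : ℤ → Ω → 𝒮) (j : ℤ) :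
    MeasurableSpace Ω :=
  MeasurableSpace.comap (fun ω (l : {l : ℤ // l < j}) => (X l ω, Y l ω, S (l - 1) ω)) inferInstance

/-- The events depending on `X_k, Y_k, S_k` for `k ≥ j`. -/
abbrev futureAlgebra (X : ℤ → Ω → ZMod 2) (Y : ℤ → Ω → 𝒴) (S : ℤ → Ω → 𝒮) (j : ℤ) :
    MeasurableSpace Ω :=
  MeasurableSpace.comap (fun ω (k : {k : ℤ // j ≤ k}) => (X k ω, Y k ω, S k ω)) inferInstance

theorem discreteMeasurable_past {j l : ℤ} (hl : l < j) :
    @DiscreteMeasurable _ _ (pastAlgebra X Y S j) (X l) ∧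
      @DiscreteMeasurable _ _ (pastAlgebra X Y S j) (Y l) ∧
      @DiscreteMeasurable _ _ (pastAlgebra X Y S j) (S (l - 1)) := by
  let _ : MeasurableSpace Ω := pastAlgebra X Y S j
  have : Measurable fun ω => (X l ω, Y l ω, S (l - 1) ω) :=
    (measurable_pi_apply (⟨l, hl⟩ : {l : ℤ // l < j})).comp (comap_measurable
      fun ω (l : {l : ℤ // l < j}) => (X l ω, Y l ω, S (l - 1) ω))
  exact ⟨this.fst.discreteMeasurable, this.snd.fst.discreteMeasurable,
    this.snd.snd.discreteMeasurable⟩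

theorem discreteMeasurable_future {j k : ℤ} (hk : j ≤ k) :
    @DiscreteMeasurable _ _ (futureAlgebra X Y S j) (X k) ∧
      @DiscreteMeasurable _ _ (futureAlgebra X Y S j) (Y k) ∧
      @DiscreteMeasurable _ _ (futureAlgebra X Y S j) (S k) := by
  let _ : MeasurableSpace Ω := futureAlgebra X Y S j
  have : Measurable fun ω => (X k ω, Y k ω, S k ω) :=
    (measurable_pi_apply (⟨k, hk⟩ : {k : ℤ // j ≤ k})).comp (comap_measurable
      fun ω (k : {k : ℤ // j ≤ k}) => (X k ω, Y k ω, S k ω))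
  exact ⟨this.fst.discreteMeasurable, this.snd.fst.discreteMeasurable,
    this.snd.snd.discreteMeasurable⟩

variable [IsProbabilityMeasure μ]

/-- The Markov property in terms of the joint law of `S_{j-1}`, the past and the future. -/
theorem IsFAIM.markov_mul (h : IsFAIM μ X Y S) (j : ℤ) (s : 𝒮) {E F : Set Ω}
    (hE : MeasurableSet[pastAlgebra X Y S j] E) (hF : MeasurableSet[futureAlgebra X Y S j] F) :
    μ.real (S (j - 1) ⁻¹' {s} ∩ (E ∩ F)) * μ.real (S (j - 1) ⁻¹' {s}) =
      μ.real (S (j - 1) ⁻¹' {s} ∩ E) * μ.real (S (j - 1) ⁻¹' {s} ∩ F) := by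
  have hs : MeasurableSet (S (j - 1) ⁻¹' {s}) := h.measurable_S _ (measurableSet_singleton s)
  have hind := (IndepFun_iff _ _ _).1 (h.markov j s) F E hF hE
  have hind' := congrArg ENNReal.toReal hind
  rw [ENNReal.toReal_mul] at hind'
  change (μ[|S (j - 1) ⁻¹' {s}]).real (F ∩ E) = (μ[|S (j - 1) ⁻¹' {s}]).real F *
    (μ[|S (j - 1) ⁻¹' {s}]).real E at hind'
  rw [← measureReal_mul_cond hs, ← measureReal_mul_cond hs, ← measureReal_mul_cond hs,
    Set.inter_comm E F, hind']
  ring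

/-- The joint probabilities `P(S_0 = a, S_N = b)`. -/
noncomputable def statePair (μ : Measure Ω) (S : ℤ → Ω → 𝒮) (N : ℕ) (a b : 𝒮) : ℝ :=
  μ.real ((fun ω => (S 0 ω, S N ω)) ⁻¹' {(a, b)})

theorem IsFAIM.discreteMeasurable_S (h : IsFAIM μ X Y S) (j : ℤ) : DiscreteMeasurable (S j) :=
  (h.measurable_S j).discreteMeasurable

theorem IsFAIM.measureReal_S (h : IsFAIM μ X Y S) (j : ℤ) (a : 𝒮) :
    μ.real (S j ⁻¹' {a}) = μ.real (S 0 ⁻¹' {a}) := by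
  have hA : DiscreteMeasurable fun p : ℤ → ZMod 2 × 𝒴 × 𝒮 => (p 0).2.2 :=
    (measurable_pi_apply (0 : ℤ)).snd.snd.discreteMeasurable
  simpa using h.measureReal_shift hA j a

theorem IsFAIM.statePair_shift (h : IsFAIM μ X Y S) (M N : ℕ) (a b : 𝒮) :
    μ.real ((fun ω => (S M ω, S ((M + N : ℕ) : ℤ) ω)) ⁻¹' {(a, b)}) = statePair μ S N a b := by
  have hA : DiscreteMeasurable fun p : ℤ → ZMod 2 × 𝒴 × 𝒮 => ((p 0).2.2, (p N).2.2) :=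
    (measurable_pi_apply (0 : ℤ)).snd.snd.discreteMeasurable.prodMk
      (measurable_pi_apply (N : ℤ)).snd.snd.discreteMeasurable
  have := h.measureReal_shift hA M (a, b)
  simpa [statePair, add_comm] using this

theorem IsFAIM.stationary_mul_transProb (h : IsFAIM μ X Y S) (N : ℕ) (a b : 𝒮) :
    μ.real (S 0 ⁻¹' {a}) * transProb μ S N a b = statePair μ S N a b := by
  rw [transProb, statePair]
  refine (measureReal_mul_cond (h.discreteMeasurable_S 0 {a}) (S N ⁻¹' {b})).trans ?_
  congr 1
  ext ω
  simp

theorem IsFAIM.stationary_pos (h : IsFAIM μ X Y S) (a : 𝒮) : 0 < μ.real (S 0 ⁻¹' {a}) := by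
  refine measureReal_nonneg.lt_of_ne fun h0 => ?_
  obtain ⟨N, -, hN⟩ := h.irreducible a a
  have : μ {ω | S 0 ω = a} = 0 := (measureReal_eq_zero_iff).1 h0.symm
  rw [transProb, cond_eq_zero_of_meas_eq_zero this] at hN
  simp at hN

theorem IsFAIM.statePair_pos_iff (h : IsFAIM μ X Y S) (N : ℕ) (a b : 𝒮) :
    0 < statePair μ S N a b ↔ 0 < transProb μ S N a b := by
  rw [← h.stationary_mul_transProb, mul_pos_iff_of_pos_left (h.stationary_pos a)]

theorem IsFAIM.sum_statePair_right (h : IsFAIM μ X Y S) (N : ℕ) (a : 𝒮) :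
    ∑ b, statePair μ S N a b = μ.real (S 0 ⁻¹' {a}) := by
  rw [← sum_measureReal_preimage_prodMk (h.discreteMeasurable_S N) (h.discreteMeasurable_S 0) a]
  refine Finset.sum_congr rfl fun b _ => ?_
  rw [statePair]
  congr 1
  ext ω
  simp [and_comm]

/-- The Chapman-Kolmogorov equation. -/
theorem IsFAIM.statePair_add (h : IsFAIM μ X Y S) {M N : ℕ} (hM : 0 < M) (hN : 0 < N)
    (a b : 𝒮) : statePair μ S (M + N) a b =
      ∑ c, statePair μ S M a c * statePair μ S N c b / μ.real (S 0 ⁻¹' {c}) := by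
  have hS := h.discreteMeasurable_S
  rw [statePair, ← sum_measureReal_preimage_prodMk (hS M) ((hS 0).prodMk (hS (M + N : ℕ)))]
  refine Finset.sum_congr rfl fun c _ => ?_
  have hE := (discreteMeasurable_past (X := X) (Y := Y) (S := S)
    (by omega : (1 : ℤ) < M + 1)).2.2 {a}
  have hF := (discreteMeasurable_future (X := X) (Y := Y) (S := S)
    (by omega : (M + 1 : ℤ) ≤ (M + N : ℕ))).2.2 {b}
  have := h.markov_mul (M + 1) c hE hF
  rw [sub_self, add_sub_cancel_right] at this
  rw [eq_div_iff (h.stationary_pos c).ne', ← h.statePair_shift M N, ← h.measureReal_S M c,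
    statePair]
  convert this using 3 <;> ext ω <;> simp [and_comm]

/-- Irreducibility and aperiodicity: for all large `N` all transitions in `N` steps are
possible. -/
theorem IsFAIM.exists_forall_statePair_pos (h : IsFAIM μ X Y S) :
    ∃ N₀ : ℕ, 0 < N₀ ∧ ∀ N, N₀ ≤ N → ∀ a b, 0 < statePair μ S N a b := by
  have hadd : ∀ {M N : ℕ} {a b c : 𝒮}, 0 < M → 0 < N → 0 < statePair μ S M a c →
      0 < statePair μ S N c b → 0 < statePair μ S (M + N) a b := by
    intro M N a b c hM hN h1 h2
    rw [h.statePair_add hM hN]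
    refine Finset.sum_pos' (fun c _ => ?_) ⟨c, Finset.mem_univ _, ?_⟩
    · exact div_nonneg (mul_nonneg measureReal_nonneg measureReal_nonneg) measureReal_nonneg
    · exact div_pos (mul_pos h1 h2) (h.stationary_pos c)
  -- the return times of `a` form an additive semigroup with greatest common divisor `1`
  have hret : ∀ a, ∃ N₀ : ℕ, ∀ N, N₀ ≤ N → 0 < N → 0 < statePair μ S N a a := by
    intro a
    set s : Set ℕ := {N | 0 < N ∧ 0 < statePair μ S N a a}
    obtain ⟨N₀, hN₀⟩ := Nat.exists_mem_closure_of_ge s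
    have hgcd : Nat.setGcd s = 1 := h.aperiodic a _ fun N hN hpos =>
      Nat.setGcd_dvd_of_mem ⟨hN, (h.statePair_pos_iff N a a).2 hpos⟩
    have hcl : ∀ N ∈ AddSubmonoid.closure s, N = 0 ∨ N ∈ s := by
      intro N hN
      induction hN using AddSubmonoid.closure_induction with
      | mem x hx => exact Or.inr hx
      | zero => exact Or.inl rfl
      | add x y _ _ hx hy =>
        rcases hx with rfl | hx
        · simpa using hy
        · rcases hy with rfl | hy
          · exact Or.inr hx
          · exact Or.inr ⟨Nat.add_pos_left hx.1 _, hadd hx.1 hy.1 hx.2 hy.2⟩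
    refine ⟨N₀, fun N hN hpos => ?_⟩
    rcases hcl N (hN₀ N hN (hgcd ▸ one_dvd N)) with h0 | h0
    · omega
    · exact h0.2
  choose R hR using hret
  choose K hK0 hK using fun a b => h.irreducible a b
  refine ⟨∑ a, R a + ∑ a, ∑ b, K a b + 1, by omega, fun N hN a b => ?_⟩
  have h1 : R a ≤ ∑ a, R a := Finset.single_le_sum (fun _ _ => Nat.zero_le _) (Finset.mem_univ a)
  have h2 : K a b ≤ ∑ b, K a b :=
    Finset.single_le_sum (f := K a) (fun _ _ => Nat.zero_le _) (Finset.mem_univ b)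
  have h3 : ∑ b, K a b ≤ ∑ a, ∑ b, K a b :=
    Finset.single_le_sum (f := fun a => ∑ b, K a b) (fun _ _ => Nat.zero_le _) (Finset.mem_univ a)
  have e : N = (N - K a b) + K a b := by omega
  rw [e]
  exact hadd (by omega) (hK0 a b) (hR a _ (by omega) (by omega))
    ((h.statePair_pos_iff _ a b).2 (hK a b))

/-- Uniform mixing: the probabilities `P(S_0 = a, S_N = b)` are bounded away from zero for all
large `N`. -/
theorem IsFAIM.exists_le_statePair (h : IsFAIM μ X Y S) :
    ∃ w : ℝ, 0 < w ∧ ∃ N₀ : ℕ, ∀ N, N₀ ≤ N → ∀ a b, w ≤ statePair μ S N a b := by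
  obtain ⟨N₀, hN₀, hpos⟩ := h.exists_forall_statePair_pos
  have : Nonempty Ω := nonempty_of_isProbabilityMeasure μ
  have : Nonempty 𝒮 := ⟨S 0 (Classical.arbitrary Ω)⟩
  obtain ⟨p, hp⟩ := Finite.exists_min fun p : 𝒮 × 𝒮 => statePair μ S N₀ p.1 p.2
  obtain ⟨s, hs⟩ := Finite.exists_min fun a : 𝒮 => μ.real (S 0 ⁻¹' {a})
  set w₀ := statePair μ S N₀ p.1 p.2
  have hw₀ : 0 < w₀ := hpos N₀ le_rfl _ _
  refine ⟨w₀ * μ.real (S 0 ⁻¹' {s}), mul_pos hw₀ (h.stationary_pos s), N₀ + 1,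
    fun N hN a b => ?_⟩
  obtain ⟨M, rfl⟩ : ∃ M, N = M + N₀ := ⟨N - N₀, by omega⟩
  rw [h.statePair_add (by omega) hN₀]
  calc w₀ * μ.real (S 0 ⁻¹' {s}) ≤ w₀ * μ.real (S 0 ⁻¹' {a}) :=
        mul_le_mul_of_nonneg_left (hs a) hw₀.le
    _ = ∑ c, w₀ * statePair μ S M a c := by rw [← Finset.mul_sum, h.sum_statePair_right]
    _ ≤ _ := Finset.sum_le_sum fun c _ => by
        rw [le_div_iff₀ (h.stationary_pos c)]
        have h1 : 0 ≤ statePair μ S M a c := measureReal_nonneg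
        have h2 : w₀ ≤ statePair μ S N₀ c b := hp (c, b)
        have h3 : μ.real (S 0 ⁻¹' {c}) ≤ 1 := measureReal_le_one
        calc w₀ * statePair μ S M a c * μ.real (S 0 ⁻¹' {c})
            ≤ w₀ * statePair μ S M a c := mul_le_of_le_one_right (by positivity) h3
          _ ≤ statePair μ S M a c * statePair μ S N₀ c b := by
            rw [mul_comm]; exact mul_le_mul_of_nonneg_left h2 h1

end Stationary

/-! ### The entropy gain of conditionally independent blocks -/

section Gain

theorem persp_binConv (φ : ℝ → ℝ) {a₀ a₁ b₀ b₁ : ℝ} (ha₀ : 0 ≤ a₀) (ha₁ : 0 ≤ a₁)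
    (hb₀ : 0 ≤ b₀) (hb₁ : 0 ≤ b₁) :
    persp φ (a₀ * b₀ + a₁ * b₁) (a₀ * b₁ + a₁ * b₀) =
      (a₀ + a₁) * (b₀ + b₁) * φ (binConv (a₁ / (a₀ + a₁)) (b₁ / (b₀ + b₁))) := by
  have e : a₀ * b₀ + a₁ * b₁ + (a₀ * b₁ + a₁ * b₀) = (a₀ + a₁) * (b₀ + b₁) := by ring
  rw [persp, e]
  rcases (add_nonneg ha₀ ha₁).eq_or_lt with h | h
  · simp [← h]
  rcases (add_nonneg hb₀ hb₁).eq_or_lt with h' | h'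
  · simp [← h']
  congr 2
  rw [binConv]
  field_simp
  ring

variable {𝒬 𝒮 : Type*} [Fintype 𝒬] [Fintype 𝒮]

/-- `J` is the joint law of a bit, its side information and the two boundary states of a block,
`π` the law of a single state, and the triple sum is the conditional entropy of the sum of the
bits of two adjacent blocks, which are independent given the state between them. -/
theorem entropy_gain_of_blocks {J : ZMod 2 → 𝒬 × 𝒮 × 𝒮 → ℝ} (hJ : ∀ u q, 0 ≤ J u q)
    {π : 𝒮 → ℝ} (hπ0 : ∀ b, 0 < π b) (hπ1 : ∀ b, π b ≤ 1) (hπs : ∑ b, π b = 1)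
    (hin : ∀ b, ∑ i : 𝒬 × 𝒮, (J 0 (i.1, i.2, b) + J 1 (i.1, i.2, b)) = π b)
    (hout : ∀ b, ∑ j : 𝒬 × 𝒮, (J 0 (j.1, b, j.2) + J 1 (j.1, b, j.2)) = π b)
    {w : ℝ} (hw : 0 < w) (hm : ∀ a b, w ≤ ∑ q, (J 0 (q, a, b) + J 1 (q, a, b)))
    {ε C : ℝ} (hgain : ∀ p ∈ Set.Icc (0 : ℝ) 1, ∀ r ∈ Set.Icc (0 : ℝ) 1,
      hFun p * (1 - hFun r) ≤ ε + C * (2 * hFun (binConv p r) - hFun p - hFun r)) :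
    posteriorAvg hFun J * (1 - posteriorAvg hFun J) ≤ 2 * (Fintype.card 𝒮 : ℝ) ^ 4 / w *
      (ε + 2 * C * (∑ b, ∑ i : 𝒬 × 𝒮, ∑ j : 𝒬 × 𝒮,
        persp hFun (J 0 (i.1, i.2, b) * J 0 (j.1, b, j.2) + J 1 (i.1, i.2, b) * J 1 (j.1, b, j.2))
          (J 0 (i.1, i.2, b) * J 1 (j.1, b, j.2) + J 1 (i.1, i.2, b) * J 0 (j.1, b, j.2)) / π b
        - posteriorAvg hFun J)) := by
  set A : 𝒬 → 𝒮 → 𝒮 → ℝ := fun q a b => J 0 (q, a, b) + J 1 (q, a, b)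
  set x : 𝒬 → 𝒮 → 𝒮 → ℝ := fun q a b => J 1 (q, a, b) / A q a b
  have hA0 : ∀ q a b, 0 ≤ A q a b := fun q a b => add_nonneg (hJ _ _) (hJ _ _)
  have hxI : ∀ q a b, x q a b ∈ Set.Icc (0 : ℝ) 1 :=
    fun q a b => posterior_mem_Icc (hJ _ _) (hJ _ _)
  set H := posteriorAvg hFun J with hH
  -- the entropy and its complement carried by a pair of boundary states
  set T : 𝒮 → 𝒮 → ℝ := fun a b => ∑ q, A q a b * hFun (x q a b) with hT
  set F : 𝒮 → 𝒮 → ℝ := fun a b => ∑ q, A q a b * (1 - hFun (x q a b)) with hF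
  have hT0 : ∀ a b, 0 ≤ T a b := fun a b => Finset.sum_nonneg fun q _ =>
    mul_nonneg (hA0 _ _ _) (hFun_nonneg (hxI _ _ _))
  have hF0 : ∀ a b, 0 ≤ F a b := fun a b => Finset.sum_nonneg fun q _ =>
    mul_nonneg (hA0 _ _ _) (by linarith [hFun_le_one (x q a b)])
  have hTF : ∀ a b, T a b + F a b = ∑ q, A q a b := fun a b => by
    rw [hT, hF, ← Finset.sum_add_distrib]
    exact Finset.sum_congr rfl fun _ _ => by ring
  have hHT : H = ∑ a, ∑ b, T a b := by
    rw [hH, posteriorAvg, Fintype.sum_prod_type_right, Fintype.sum_prod_type]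
    rfl
  have hout' : ∀ b, ∑ c, ∑ q, A q b c = π b := fun b => by
    rw [← hout, Fintype.sum_prod_type_right]
  have hHF : 1 - H = ∑ a, ∑ b, F a b := by
    rw [hHT, ← hπs, sub_eq_iff_eq_add, ← Finset.sum_add_distrib]
    refine Finset.sum_congr rfl fun a _ => ?_
    rw [← Finset.sum_add_distrib, ← hout']
    exact Finset.sum_congr rfl fun b _ => by rw [← hTF, add_comm]
  have hle1 : ∀ a b, ∑ q, A q a b ≤ 1 := fun a b =>
    ((Finset.single_le_sum (f := fun b => ∑ q, A q a b)
      (fun _ _ => Finset.sum_nonneg fun _ _ => hA0 _ _ _) (Finset.mem_univ b)).trans_eq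
      (hout' a)).trans (hπ1 a)
  set Hs := ∑ b, ∑ i : 𝒬 × 𝒮, ∑ j : 𝒬 × 𝒮,
    persp hFun (J 0 (i.1, i.2, b) * J 0 (j.1, b, j.2) + J 1 (i.1, i.2, b) * J 1 (j.1, b, j.2))
      (J 0 (i.1, i.2, b) * J 1 (j.1, b, j.2) + J 1 (i.1, i.2, b) * J 0 (j.1, b, j.2)) / π b with hHs
  set η := ε + 2 * C * (Hs - H) with hη
  have hprod : ∀ (f g : 𝒬 × 𝒮 → ℝ) (b : 𝒮),
      ∑ i, ∑ j, f i * g j / π b = (∑ i, f i) * (∑ j, g j) / π b := fun f g b => by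
    rw [Finset.sum_mul_sum, Finset.sum_div]
    exact Finset.sum_congr rfl fun _ _ => by rw [Finset.sum_div]
  have hTin : ∀ b, ∑ i : 𝒬 × 𝒮, A i.1 i.2 b * hFun (x i.1 i.2 b) = ∑ a, T a b := fun b => by
    rw [Fintype.sum_prod_type_right]
  have hTout : ∀ b, ∑ j : 𝒬 × 𝒮, A j.1 b j.2 * hFun (x j.1 b j.2) = ∑ c, T b c := fun b => by
    rw [Fintype.sum_prod_type_right]
  have hFout : ∀ b, ∑ j : 𝒬 × 𝒮, A j.1 b j.2 * (1 - hFun (x j.1 b j.2)) = ∑ c, F b c :=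
    fun b => by rw [Fintype.sum_prod_type_right]
  -- the average of the single-letter inequality
  have key : ∑ b, (∑ a, T a b) * (∑ c, F b c) / π b ≤ η := by
    have h1 : ∀ b, (∑ a, T a b) * (∑ c, F b c) / π b ≤
        ε * π b + C * (2 * (∑ i : 𝒬 × 𝒮, ∑ j : 𝒬 × 𝒮, A i.1 i.2 b * A j.1 b j.2 *
          hFun (binConv (x i.1 i.2 b) (x j.1 b j.2)) / π b) - ∑ a, T a b - ∑ c, T b c) := by
      intro b
      have hb := (hπ0 b).ne'
      have e1 : ε * π b = ∑ i : 𝒬 × 𝒮, ∑ j : 𝒬 × 𝒮, ε * (A i.1 i.2 b * A j.1 b j.2 / π b) := by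
        simp only [← Finset.mul_sum]
        rw [hprod (fun i => A i.1 i.2 b) (fun j => A j.1 b j.2), hin, hout]
        field_simp
      have e2 : ∑ a, T a b = ∑ i : 𝒬 × 𝒮, ∑ j : 𝒬 × 𝒮,
          (A i.1 i.2 b * hFun (x i.1 i.2 b)) * A j.1 b j.2 / π b := by
        rw [hprod (fun i => A i.1 i.2 b * hFun (x i.1 i.2 b)) (fun j => A j.1 b j.2), hout, hTin,
          mul_div_cancel_right₀ _ hb]
      have e3 : ∑ c, T b c = ∑ i : 𝒬 × 𝒮, ∑ j : 𝒬 × 𝒮,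
          A i.1 i.2 b * (A j.1 b j.2 * hFun (x j.1 b j.2)) / π b := by
        rw [hprod (fun i => A i.1 i.2 b) (fun j => A j.1 b j.2 * hFun (x j.1 b j.2)), hin, hTout,
          mul_div_cancel_left₀ _ hb]
      rw [← hFout, ← hTin, ← hprod (fun i => A i.1 i.2 b * hFun (x i.1 i.2 b)), hTin, e1, e2, e3]
      simp only [Finset.mul_sum, ← Finset.sum_sub_distrib, ← Finset.sum_add_distrib]
      refine Finset.sum_le_sum fun i _ => Finset.sum_le_sum fun j _ => ?_
      have hg := hgain _ (hxI i.1 i.2 b) _ (hxI j.1 b j.2)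
      have hw' : 0 ≤ A i.1 i.2 b * A j.1 b j.2 / π b :=
        div_nonneg (mul_nonneg (hA0 _ _ _) (hA0 _ _ _)) (hπ0 b).le
      calc A i.1 i.2 b * hFun (x i.1 i.2 b) * (A j.1 b j.2 * (1 - hFun (x j.1 b j.2))) / π b
          = A i.1 i.2 b * A j.1 b j.2 / π b *
            (hFun (x i.1 i.2 b) * (1 - hFun (x j.1 b j.2))) := by ring
        _ ≤ _ := mul_le_mul_of_nonneg_left hg hw'
        _ = _ := by ring
    refine (Finset.sum_le_sum fun b _ => h1 b).trans (le_of_eq ?_)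
    have hHT' : ∑ b, ∑ a, T a b = H := by rw [hHT, Finset.sum_comm]
    rw [Finset.sum_add_distrib, ← Finset.mul_sum, hπs, ← Finset.mul_sum, Finset.sum_sub_distrib,
      Finset.sum_sub_distrib, ← Finset.mul_sum, hHT', ← hHT, hη, hHs]
    simp only [persp_binConv hFun (hJ _ _) (hJ _ _) (hJ _ _) (hJ _ _)]
    ring
  have hη0 : 0 ≤ η := (Finset.sum_nonneg fun b _ => div_nonneg (mul_nonneg
    (Finset.sum_nonneg fun _ _ => hT0 _ _) (Finset.sum_nonneg fun _ _ => hF0 _ _))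
    (hπ0 b).le).trans key
  have hconn : ∀ a b c, T a b * F b c ≤ η := by
    intro a b c
    have h1 : T a b ≤ ∑ a, T a b :=
      Finset.single_le_sum (f := fun a => T a b) (fun _ _ => hT0 _ _) (Finset.mem_univ a)
    have h2 : F b c ≤ ∑ c, F b c :=
      Finset.single_le_sum (f := fun c => F b c) (fun _ _ => hF0 _ _) (Finset.mem_univ c)
    have h3 : (∑ a, T a b) * (∑ c, F b c) / π b ≤ η :=
      (Finset.single_le_sum (f := fun b => (∑ a, T a b) * (∑ c, F b c) / π b)
        (fun b _ => div_nonneg (mul_nonneg (Finset.sum_nonneg fun _ _ => hT0 _ _)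
          (Finset.sum_nonneg fun _ _ => hF0 _ _)) (hπ0 b).le) (Finset.mem_univ b)).trans key
    rw [div_le_iff₀ (hπ0 b)] at h3
    have h4 := mul_le_mul h1 h2 (hF0 b c) ((hT0 a b).trans h1)
    nlinarith [hπ1 b]
  -- a pair of transitions that are not adjacent is linked by a third one, of mass at least `w`
  have hpair : ∀ a b c d, T a b * F c d ≤ 2 * η / w := by
    intro a b c d
    have hb1 : T a b ≤ 1 := by have := hTF a b; linarith [hle1 a b, hF0 a b]
    have hd1 : F c d ≤ 1 := by have := hTF c d; linarith [hle1 c d, hT0 c d]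
    have h1 : w ≤ T b c + F b c := (hm b c).trans_eq (hTF b c).symm
    have h2 := hconn a b c
    have h3 := hconn b c d
    rw [le_div_iff₀ hw]
    have h4 := mul_le_mul_of_nonneg_left h1 (mul_nonneg (hT0 a b) (hF0 c d))
    have h5 : T a b * F b c * F c d ≤ η :=
      (mul_le_of_le_one_right (mul_nonneg (hT0 _ _) (hF0 _ _)) hd1).trans h2
    have h6 : T b c * F c d * T a b ≤ η :=
      (mul_le_of_le_one_right (mul_nonneg (hT0 _ _) (hF0 _ _)) hb1).trans h3
    linarith
  have hfin : H * (1 - H) = ∑ a, ∑ b, ∑ c, ∑ d, T a b * F c d := by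
    rw [hHF, hHT]
    simp only [← Finset.sum_mul, ← Finset.mul_sum]
  rw [hfin]
  calc ∑ a, ∑ b, ∑ c, ∑ d, T a b * F c d
      ≤ ∑ _a : 𝒮, ∑ _b : 𝒮, ∑ _c : 𝒮, ∑ _d : 𝒮, 2 * η / w :=
        Finset.sum_le_sum fun a _ => Finset.sum_le_sum fun b _ => Finset.sum_le_sum fun c _ =>
          Finset.sum_le_sum fun d _ => hpair a b c d
    _ = 2 * (Fintype.card 𝒮 : ℝ) ^ 4 / w * η := by
        simp only [Finset.sum_const, Finset.card_univ, nsmul_eq_mul]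
        ring

end Gain

/-! ### Entropies of the transformed process -/

section Blocks

set_option linter.unusedSectionVars false

variable {Ω 𝒴 𝒮 : Type*} [MeasurableSpace Ω]
  [Fintype 𝒴] [MeasurableSpace 𝒴] [MeasurableSingletonClass 𝒴]
  [Fintype 𝒮] [MeasurableSpace 𝒮] [MeasurableSingletonClass 𝒮]

/-- The side information of an index together with the boundary states of the block. -/
def stateQ (X : ℤ → Ω → ZMod 2) (Y : ℤ → Ω → 𝒴) (S : ℤ → Ω → 𝒮) (n : ℕ) (i : Fin (2 ^ n))
    (ω : Ω) : (({k : Fin (2 ^ n) // k < i} → ZMod 2) × (Fin (2 ^ n) → 𝒴)) × 𝒮 × 𝒮 :=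
  (polarQ X Y n i ω, S 0 ω, S (2 ^ n) ω)

/-- The conditional entropy `H(U_i|Q_i)` of an index. -/
noncomputable def indexEntropy (μ : Measure Ω) (X : ℤ → Ω → ZMod 2) (Y : ℤ → Ω → 𝒴) (n : ℕ)
    (i : Fin (2 ^ n)) : ℝ :=
  condEntropy μ (fun ω => polarU X n ω i) (polarQ X Y n i)

/-- The conditional entropy `H(U_i|Q_i, S_0, S_N)` of an index. -/
noncomputable def stateEntropy (μ : Measure Ω) (X : ℤ → Ω → ZMod 2) (Y : ℤ → Ω → 𝒴)
    (S : ℤ → Ω → 𝒮) (n : ℕ) (i : Fin (2 ^ n)) : ℝ :=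
  condEntropy μ (fun ω => polarU X n ω i) (stateQ X Y S n i)

variable {μ : Measure Ω} {X : ℤ → Ω → ZMod 2} {Y : ℤ → Ω → 𝒴} {S : ℤ → Ω → 𝒮}

theorem IsFAIM.discreteMeasurable_U (h : IsFAIM μ X Y S) (n : ℕ) (i : Fin (2 ^ n)) :
    DiscreteMeasurable fun ω => polarU X n ω i :=
  (discreteMeasurable_polarU fun _ _ => (h.measurable_X _).discreteMeasurable).comp fun u => u i

theorem IsFAIM.discreteMeasurable_Q (h : IsFAIM μ X Y S) (n : ℕ) (i : Fin (2 ^ n)) :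
    DiscreteMeasurable (polarQ X Y n i) :=
  discreteMeasurable_polarQ (fun _ _ => (h.measurable_X _).discreteMeasurable)
    (fun _ _ => (h.measurable_Y _).discreteMeasurable) i

theorem IsFAIM.discreteMeasurable_stateQ (h : IsFAIM μ X Y S) (n : ℕ) (i : Fin (2 ^ n)) :
    DiscreteMeasurable (stateQ X Y S n i) :=
  (h.discreteMeasurable_Q n i).prodMk
    ((h.measurable_S _).discreteMeasurable.prodMk (h.measurable_S _).discreteMeasurable)

theorem IsFAIM.discreteMeasurable_shift_U (h : IsFAIM μ X Y S) (n : ℕ) (i : Fin (2 ^ n)) :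
    DiscreteMeasurable fun ω => polarU (shift X n) n ω i :=
  (discreteMeasurable_polarU (X := shift X n) fun _ _ =>
    (h.measurable_X _).discreteMeasurable).comp fun u => u i

theorem IsFAIM.discreteMeasurable_shift_Q (h : IsFAIM μ X Y S) (n : ℕ) (i : Fin (2 ^ n)) :
    DiscreteMeasurable (polarQ (shift X n) (shift Y n) n i) :=
  discreteMeasurable_polarQ (X := shift X n) (Y := shift Y n)
    (fun _ _ => (h.measurable_X _).discreteMeasurable)
    (fun _ _ => (h.measurable_Y _).discreteMeasurable) i

/-- By stationarity, the law of a bit, its side information and the boundary states is the same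
for adjacent blocks. -/
theorem IsFAIM.joint_shift_stateQ (h : IsFAIM μ X Y S) (n : ℕ) (i : Fin (2 ^ n)) :
    joint μ (fun ω => polarU (shift X n) n ω i)
        (stateQ (shift X n) (shift Y n) (shift S n) n i) =
      joint μ (fun ω => polarU X n ω i) (stateQ X Y S n i) := by
  funext u q
  rw [joint_eq, joint_eq]
  -- the same functional on the canonical space
  have hX : ∀ j : ℤ, DiscreteMeasurable fun p : ℤ → ZMod 2 × 𝒴 × 𝒮 => (p j).1 :=
    fun j => (measurable_pi_apply j).fst.discreteMeasurable
  have hY : ∀ j : ℤ, DiscreteMeasurable fun p : ℤ → ZMod 2 × 𝒴 × 𝒮 => (p j).2.1 :=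
    fun j => (measurable_pi_apply j).snd.fst.discreteMeasurable
  have hS : ∀ j : ℤ, DiscreteMeasurable fun p : ℤ → ZMod 2 × 𝒴 × 𝒮 => (p j).2.2 :=
    fun j => (measurable_pi_apply j).snd.snd.discreteMeasurable
  have hA : DiscreteMeasurable fun p : ℤ → ZMod 2 × 𝒴 × 𝒮 =>
      (polarU (fun j (p : ℤ → ZMod 2 × 𝒴 × 𝒮) => (p j).1) n p i,
        stateQ (fun j (p : ℤ → ZMod 2 × 𝒴 × 𝒮) => (p j).1) (fun j p => (p j).2.1)
          (fun j p => (p j).2.2) n i p) :=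
    ((discreteMeasurable_polarU fun _ _ => hX _).comp fun u => u i).prodMk
      ((discreteMeasurable_polarQ (fun _ _ => hX _) (fun _ _ => hY _) i).prodMk
        ((hS _).prodMk (hS _)))
  exact h.measureReal_shift hA (2 ^ n) (u, q)

variable [IsProbabilityMeasure μ]

theorem IsFAIM.condEntropy_shift (h : IsFAIM μ X Y S) (n : ℕ) (i : Fin (2 ^ n)) :
    condEntropy μ (fun ω => polarU (shift X n) n ω i) (polarQ (shift X n) (shift Y n) n i) =
      indexEntropy μ X Y n i := by
  have hsum : ∀ (U : Ω → ZMod 2) (Q : Ω → (({k : Fin (2 ^ n) // k < i} → ZMod 2) ×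
      (Fin (2 ^ n) → 𝒴)) × 𝒮 × 𝒮), DiscreteMeasurable U → DiscreteMeasurable Q →
      ∀ u q, joint μ U (fun ω => (Q ω).1) u q = ∑ s, joint μ U Q u (q, s) := by
    intro U Q hU hQ u q
    rw [joint_eq, ← sum_measureReal_preimage_prodMk (hQ.comp Prod.snd)
      (hU.prodMk (hQ.comp Prod.fst))]
    refine Finset.sum_congr rfl fun s _ => ?_
    rw [joint_eq]
    congr 1
    ext ω
    simp [Prod.ext_iff]
    tauto
  rw [indexEntropy, condEntropy_eq_posteriorAvg, condEntropy_eq_posteriorAvg]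
  congr 1
  funext u q
  refine (hsum _ (stateQ (shift X n) (shift Y n) (shift S n) n i)
    (h.discreteMeasurable_shift_U n i) ((h.discreteMeasurable_shift_Q n i).prodMk
      ((h.measurable_S _).discreteMeasurable.prodMk
        (h.measurable_S _).discreteMeasurable)) u q).trans ?_
  rw [h.joint_shift_stateQ]
  exact (hsum _ _ (h.discreteMeasurable_U n i) (h.discreteMeasurable_stateQ n i) u q).symm

/-- The chain rule for one polarization step: the average of the entropies of the two descendants
of an index is at most the entropy of the index. -/
theorem IsFAIM.indexEntropy_child_add_le (h : IsFAIM μ X Y S) {n : ℕ} (i : Fin (2 ^ n)) :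
    indexEntropy μ X Y (n + 1) (child i 0) + indexEntropy μ X Y (n + 1) (child i 1) ≤
      2 * indexEntropy μ X Y n i := by
  have hU := h.discreteMeasurable_U n i
  have hV := h.discreteMeasurable_shift_U n i
  have hQ := h.discreteMeasurable_Q n i
  have hR := h.discreteMeasurable_shift_Q n i
  have hU0 := h.discreteMeasurable_U (n + 1) (child i 0)
  have hU1 := h.discreteMeasurable_U (n + 1) (child i 1)
  have hQ0 := h.discreteMeasurable_Q (n + 1) (child i 0)
  have hQ1 := h.discreteMeasurable_Q (n + 1) (child i 1)
  set U := fun ω => polarU X n ω i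
  set V := fun ω => polarU (shift X n) n ω i
  set Q := polarQ X Y n i
  set R := polarQ (shift X n) (shift Y n) n i
  have e1 : entropy μ (polarQ X Y (n + 1) (child i 1)) =
      entropy μ fun ω => (polarU X (n + 1) ω (child i 0), polarQ X Y (n + 1) (child i 0) ω) :=
    entropy_congr hQ1 (hU0.prodMk hQ0) fun ω ω' => by
      rw [polarQ_child_one_eq_iff, and_comm]
      simp only [Prod.mk.injEq]
  have e2 : entropy μ (polarQ X Y (n + 1) (child i 0)) = entropy μ fun ω => (Q ω, R ω) :=
    entropy_congr hQ0 (hQ.prodMk hR) fun ω ω' => by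
      rw [polarQ_child_zero_eq_iff]
      simp only [Prod.mk.injEq, Q, R]
  have e3 : entropy μ (fun ω =>
        (polarU X (n + 1) ω (child i 1), polarQ X Y (n + 1) (child i 1) ω)) =
      entropy μ fun ω => (V ω, (U ω, (Q ω, R ω))) :=
    entropy_congr (hU1.prodMk hQ1) (hV.prodMk (hU.prodMk (hQ.prodMk hR))) fun ω ω' => by
      simp only [Prod.mk.injEq, polarQ_child_one_eq_iff, polarQ_child_zero_eq_iff,
        polarU_child_one, polarU_child_zero, U, V, Q, R]
      refine and_congr_right fun hv => ?_
      rw [hv, add_left_inj]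
      exact and_comm
  have d1 : condEntropy μ V (fun ω => (U ω, (Q ω, R ω))) ≤ condEntropy μ V R :=
    condEntropy_le_of_factorsThrough hV (hU.prodMk (hQ.prodMk hR)) fun ω ω' hω => by
      simp only [Prod.mk.injEq] at hω
      exact hω.2.2
  have d2 : condEntropy μ U (fun ω => (Q ω, R ω)) ≤ condEntropy μ U Q :=
    condEntropy_le_of_factorsThrough hU (hQ.prodMk hR) fun ω ω' hω => by
      simp only [Prod.mk.injEq] at hω
      exact hω.1
  rw [condEntropy_eq_entropy_sub hV (hU.prodMk (hQ.prodMk hR))] at d1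
  rw [condEntropy_eq_entropy_sub hU (hQ.prodMk hR)] at d2
  have e4 : condEntropy μ V R = indexEntropy μ X Y n i := h.condEntropy_shift n i
  rw [e4] at d1
  have e5 : condEntropy μ U Q = indexEntropy μ X Y n i := rfl
  rw [e5] at d2
  rw [two_mul]
  refine le_trans (le_of_eq ?_) (add_le_add d1 d2)
  rw [indexEntropy, indexEntropy, condEntropy_eq_entropy_sub hU0 hQ0,
    condEntropy_eq_entropy_sub hU1 hQ1, e1, e2, e3]
  ring

theorem IsFAIM.stateEntropy_le (h : IsFAIM μ X Y S) (n : ℕ) (i : Fin (2 ^ n)) :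
    stateEntropy μ X Y S n i ≤ indexEntropy μ X Y n i :=
  condEntropy_le_of_factorsThrough (h.discreteMeasurable_U n i) (h.discreteMeasurable_stateQ n i)
    fun _ _ hω => congrArg Prod.fst hω

/-- By the chain rule, the total information of the boundary states about the transformed bits is
bounded independently of the length of the block. -/
theorem IsFAIM.sum_indexEntropy_sub_le (h : IsFAIM μ X Y S) (n : ℕ) :
    ∑ i, (indexEntropy μ X Y n i - stateEntropy μ X Y S n i) ≤
      Fintype.card (𝒮 × 𝒮) / Real.log 2 := by
  -- the first `t` transformed bits and the observations
  set A : ℕ → Ω → (Fin (2 ^ n) → ZMod 2) × (Fin (2 ^ n) → 𝒴) := fun t ω =>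
    (fun k => if (k : ℕ) < t then polarU X n ω k else 0, fun k => Y ((k : ℤ) + 1) ω) with hAd
  set T : Ω → 𝒮 × 𝒮 := fun ω => (S 0 ω, S (2 ^ n) ω)
  have hA : ∀ t, DiscreteMeasurable (A t) := fun t =>
    ((discreteMeasurable_polarU fun _ _ => (h.measurable_X _).discreteMeasurable).comp
      fun u (k : Fin (2 ^ n)) => if (k : ℕ) < t then u k else 0).prodMk
      (DiscreteMeasurable.pi fun k : Fin (2 ^ n) => (h.measurable_Y _).discreteMeasurable)
  have hT : DiscreteMeasurable T :=
    (h.measurable_S _).discreteMeasurable.prodMk (h.measurable_S _).discreteMeasurable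
  have hAeq : ∀ t ω ω', A t ω = A t ω' ↔
      (∀ k : Fin (2 ^ n), (k : ℕ) < t → polarU X n ω k = polarU X n ω' k) ∧
        ∀ k : ℕ, k < 2 ^ n → Y (k + 1) ω = Y (k + 1) ω' := by
    intro t ω ω'
    simp only [hAd, Prod.mk.injEq, funext_iff, Fin.forall_iff]
    refine and_congr_left fun _ => forall_congr' fun k => forall_congr' fun hk => ?_
    split_ifs with hkt <;> simp [hkt]
  have hQA : ∀ (i : Fin (2 ^ n)) ω ω', polarQ X Y n i ω = polarQ X Y n i ω' ↔
      A i ω = A i ω' := fun i ω ω' => by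
    rw [polarQ_eq_iff, hAeq]; rfl
  have hUA : ∀ (i : Fin (2 ^ n)) ω ω', A (i + 1) ω = A (i + 1) ω' ↔
      polarU X n ω i = polarU X n ω' i ∧ polarQ X Y n i ω = polarQ X Y n i ω' := by
    intro i ω ω'
    rw [hAeq, polarQ_eq_iff, ← and_assoc]
    refine and_congr_left fun _ => ?_
    have e : ∀ k : Fin (2 ^ n), (k : ℕ) < i + 1 ↔ k = i ∨ k < i := by
      intro k; rw [Fin.ext_iff, Fin.lt_def]; omega
    simp only [e, or_imp, forall_and, forall_eq]
  -- the entropy of the boundary states given the first `t` bits and the observations; its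
  -- decrements are the differences in question, so that their sum telescopes
  set G : ℕ → ℝ := fun t => entropy μ (fun ω => (T ω, A t ω)) - entropy μ (A t) with hG
  have hstep : ∀ i : Fin (2 ^ n), indexEntropy μ X Y n i - stateEntropy μ X Y S n i =
      (G i - G (i + 1)) / Real.log 2 := by
    intro i
    have hU := h.discreteMeasurable_U n i
    have hQ := h.discreteMeasurable_Q n i
    have hSQ := h.discreteMeasurable_stateQ n i
    rw [indexEntropy, stateEntropy, condEntropy_eq_entropy_sub hU hQ,
      condEntropy_eq_entropy_sub hU hSQ, hG]
    have e1 : entropy μ (polarQ X Y n i) = entropy μ (A i) := entropy_congr hQ (hA _) (hQA i)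
    have e2 : entropy μ (fun ω => (polarU X n ω i, polarQ X Y n i ω)) = entropy μ (A (i + 1)) :=
      entropy_congr (hU.prodMk hQ) (hA _) fun ω ω' => by simp only [hUA, Prod.mk.injEq]
    have e3 : entropy μ (stateQ X Y S n i) = entropy μ (fun ω => (T ω, A i ω)) :=
      entropy_congr hSQ (hT.prodMk (hA _)) fun ω ω' => by
        simp only [stateQ, Prod.mk.injEq, ← hQA, T]
        exact and_comm
    have e4 : entropy μ (fun ω => (polarU X n ω i, stateQ X Y S n i ω)) =
        entropy μ (fun ω => (T ω, A (i + 1) ω)) :=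
      entropy_congr (hU.prodMk hSQ) (hT.prodMk (hA _)) fun ω ω' => by
        simp only [stateQ, Prod.mk.injEq, hUA, T]
        tauto
    simp only [e1, e2, e3, e4]
    ring
  simp only [hstep]
  rw [← Finset.sum_div, Fin.sum_univ_eq_sum_range (fun t => G t - G (t + 1)),
    Finset.sum_range_sub']
  refine div_le_div_of_nonneg_right ?_ (Real.log_nonneg one_le_two)
  have h0 : G 0 ≤ Fintype.card (𝒮 × 𝒮) := by
    have := entropy_prodMk_le (μ := μ) hT (hA 0)
    simp only [hG]
    linarith
  have h1 : 0 ≤ G (2 ^ n) := sub_nonneg.2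
    (entropy_le_of_factorsThrough (hT.prodMk (hA _)) fun _ _ hω => congrArg Prod.snd hω)
  linarith

/-- The joint law of the sum of the bits of two adjacent blocks with the side information and all
the boundary states, in terms of the law of a single block. -/
theorem IsFAIM.joint_add_block (h : IsFAIM μ X Y S) {n : ℕ} (i : Fin (2 ^ n)) (u : ZMod 2)
    (b a c : 𝒮) (q r : ({k : Fin (2 ^ n) // k < i} → ZMod 2) × (Fin (2 ^ n) → 𝒴)) :
    joint μ (fun ω => polarU X n ω i + polarU (shift X n) n ω i)
        (fun ω => (S (2 ^ n) ω, (polarQ X Y n i ω, S 0 ω),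
          (polarQ (shift X n) (shift Y n) n i ω, shift S n (2 ^ n) ω))) u (b, (q, a), (r, c)) =
      (μ.real (S 0 ⁻¹' {b}))⁻¹ *
        ∑ v, joint μ (fun ω => polarU X n ω i) (stateQ X Y S n i) v (q, a, b) *
          joint μ (fun ω => polarU X n ω i) (stateQ X Y S n i) (u - v) (r, b, c) := by
  have hU := h.discreteMeasurable_U n i
  have hV := h.discreteMeasurable_shift_U n i
  have hQ := h.discreteMeasurable_Q n i
  have hR := h.discreteMeasurable_shift_Q n i
  have hS := h.discreteMeasurable_S
  have hUV : DiscreteMeasurable fun ω => polarU X n ω i + polarU (shift X n) n ω i :=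
    (hU.prodMk hV).comp fun p => p.1 + p.2
  have hSn : DiscreteMeasurable (shift S n (2 ^ n)) := hS _
  have hpow : (1 : ℤ) ≤ 2 ^ n := one_le_pow₀ one_le_two
  rw [joint_eq, ← sum_measureReal_preimage_prodMk hU (hUV.prodMk ((hS _).prodMk
    ((hQ.prodMk (hS _)).prodMk (hR.prodMk hSn)))), Finset.mul_sum]
  refine Finset.sum_congr rfl fun v _ => ?_
  have hXp : ∀ k : ℕ, k < 2 ^ n →
      @DiscreteMeasurable _ _ (pastAlgebra X Y S (2 ^ n + 1)) (X (k + 1)) := fun k hk =>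
    (discreteMeasurable_past (by have : (k : ℤ) < 2 ^ n := by exact_mod_cast hk
                                 omega)).1
  have hYp : ∀ k : ℕ, k < 2 ^ n →
      @DiscreteMeasurable _ _ (pastAlgebra X Y S (2 ^ n + 1)) (Y (k + 1)) := fun k hk =>
    (discreteMeasurable_past (by have : (k : ℤ) < 2 ^ n := by exact_mod_cast hk
                                 omega)).2.1
  have hXf : ∀ k : ℕ, k < 2 ^ n →
      @DiscreteMeasurable _ _ (futureAlgebra X Y S (2 ^ n + 1)) (shift X n (k + 1)) := fun k _ =>
    (discreteMeasurable_future (by omega)).1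
  have hYf : ∀ k : ℕ, k < 2 ^ n →
      @DiscreteMeasurable _ _ (futureAlgebra X Y S (2 ^ n + 1)) (shift Y n (k + 1)) := fun k _ =>
    (discreteMeasurable_future (by omega)).2.1
  have hE : MeasurableSet[pastAlgebra X Y S (2 ^ n + 1)]
      ((fun ω => (polarU X n ω i, polarQ X Y n i ω, S 0 ω)) ⁻¹' {(v, q, a)}) := by
    let _ : MeasurableSpace Ω := pastAlgebra X Y S (2 ^ n + 1)
    exact ((discreteMeasurable_polarU hXp).comp fun u => u i).prodMk
      ((discreteMeasurable_polarQ hXp hYp i).prodMk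
        (discreteMeasurable_past (l := 1) (by omega)).2.2) _
  have hF : MeasurableSet[futureAlgebra X Y S (2 ^ n + 1)]
      ((fun ω => (polarU (shift X n) n ω i, polarQ (shift X n) (shift Y n) n i ω,
        shift S n (2 ^ n) ω)) ⁻¹' {(u - v, r, c)}) := by
    let _ : MeasurableSpace Ω := futureAlgebra X Y S (2 ^ n + 1)
    exact ((discreteMeasurable_polarU hXf).comp fun u => u i).prodMk
      ((discreteMeasurable_polarQ hXf hYf i).prodMk
        (discreteMeasurable_future (k := 2 ^ n + 2 ^ n) (by omega)).2.2) _
  have hM := h.markov_mul (2 ^ n + 1) b hE hF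
  rw [add_sub_cancel_right, h.measureReal_S] at hM
  have s1 : joint μ (fun ω => polarU X n ω i) (stateQ X Y S n i) v (q, a, b) =
      μ.real (S (2 ^ n) ⁻¹' {b} ∩
        (fun ω => (polarU X n ω i, polarQ X Y n i ω, S 0 ω)) ⁻¹' {(v, q, a)}) := by
    rw [joint_eq]
    congr 1
    ext ω
    simp only [stateQ, Set.mem_preimage, Set.mem_singleton_iff, Set.mem_inter_iff, Prod.mk.injEq]
    tauto
  have s2 : joint μ (fun ω => polarU X n ω i) (stateQ X Y S n i) (u - v) (r, b, c) =
      μ.real (S (2 ^ n) ⁻¹' {b} ∩ (fun ω => (polarU (shift X n) n ω i,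
        polarQ (shift X n) (shift Y n) n i ω, shift S n (2 ^ n) ω)) ⁻¹' {(u - v, r, c)}) := by
    rw [← h.joint_shift_stateQ, joint_eq]
    congr 1
    ext ω
    have e : shift S n 0 ω = S (2 ^ n) ω := by rw [shift, zero_add]
    simp only [stateQ, Set.mem_preimage, Set.mem_singleton_iff, Set.mem_inter_iff, Prod.mk.injEq,
      e]
    tauto
  rw [eq_inv_mul_iff_mul_eq₀ (h.stationary_pos b).ne', s1, s2, ← hM, mul_comm]
  congr 2
  ext ω
  simp only [Set.mem_preimage, Set.mem_singleton_iff, Set.mem_inter_iff, Prod.mk.injEq]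
  constructor
  · rintro ⟨h1, h2, h3, ⟨h4, h5⟩, h6, h7⟩
    exact ⟨h3, ⟨h1, h4, h5⟩, eq_sub_of_add_eq' (h1 ▸ h2), h6, h7⟩
  · rintro ⟨h3, ⟨h1, h4, h5⟩, h2, h6, h7⟩
    exact ⟨h1, by rw [h1, h2, add_sub_cancel], h3, ⟨h4, h5⟩, h6, h7⟩

/-- The entropy of the first descendant of an index, in terms of the law of a single block. -/
theorem IsFAIM.le_indexEntropy_child_zero (h : IsFAIM μ X Y S) {n : ℕ} (i : Fin (2 ^ n)) :
    let J := joint μ (fun ω => polarU X n ω i) (stateQ X Y S n i)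
    ∑ b : 𝒮, ∑ k : (({k : Fin (2 ^ n) // k < i} → ZMod 2) × (Fin (2 ^ n) → 𝒴)) × 𝒮,
      ∑ l : (({k : Fin (2 ^ n) // k < i} → ZMod 2) × (Fin (2 ^ n) → 𝒴)) × 𝒮,
        persp hFun (J 0 (k.1, k.2, b) * J 0 (l.1, b, l.2) + J 1 (k.1, k.2, b) * J 1 (l.1, b, l.2))
          (J 0 (k.1, k.2, b) * J 1 (l.1, b, l.2) + J 1 (k.1, k.2, b) * J 0 (l.1, b, l.2)) /
          μ.real (S 0 ⁻¹' {b}) ≤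
      indexEntropy μ X Y (n + 1) (child i 0) := by
  intro J
  have hU := h.discreteMeasurable_U n i
  have hV := h.discreteMeasurable_shift_U n i
  have hQ := h.discreteMeasurable_Q n i
  have hR := h.discreteMeasurable_shift_Q n i
  have hS := h.discreteMeasurable_S
  have hW := (hS (2 ^ n)).prodMk ((hQ.prodMk (hS 0)).prodMk (hR.prodMk (hS (2 ^ n + 2 ^ n))))
  have hle := condEntropy_le_of_factorsThrough (μ := μ)
    (Q := polarQ X Y (n + 1) (child i 0)) ((hU.prodMk hV).comp fun p => p.1 + p.2) hW
    fun ω ω' hω => by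
      simp only [Prod.mk.injEq] at hω
      rw [polarQ_child_zero_eq_iff]
      exact ⟨hω.2.1.1, hω.2.2.1⟩
  have e : (fun ω => polarU X n ω i + polarU (shift X n) n ω i) =
      fun ω => polarU X (n + 1) ω (child i 0) := funext fun ω => (polarU_child_zero X ω i).symm
  rw [e] at hle
  refine le_trans (le_of_eq ?_) hle
  rw [← e]
  rw [condEntropy_eq_posteriorAvg, posteriorAvg, Fintype.sum_prod_type]
  refine Finset.sum_congr rfl fun b _ => ?_
  refine Eq.trans ?_ (Fintype.sum_prod_type _).symm
  refine Finset.sum_congr rfl fun k _ => Finset.sum_congr rfl fun l _ => ?_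
  have e0 := h.joint_add_block i 0 b k.2 l.2 k.1 l.1
  have e1 := h.joint_add_block i 1 b k.2 l.2 k.1 l.1
  rw [sum_zmod_two, show (0 : ZMod 2) - 0 = 0 by decide, show (0 : ZMod 2) - 1 = 1 by decide] at e0
  rw [sum_zmod_two, show (1 : ZMod 2) - 0 = 1 by decide, show (1 : ZMod 2) - 1 = 0 by decide] at e1
  rw [div_eq_inv_mul, ← persp_smul]
  exact (congrArg₂ (persp hFun) e0 e1).symm

/-- For long blocks, the first descendant of an index has notably more entropy than the index has
given the boundary states, unless the latter entropy is close to `0` or `1`. -/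
theorem IsFAIM.exists_entropy_gain (h : IsFAIM μ X Y S) {ε : ℝ} (hε : 0 < ε) :
    ∃ (C : ℝ) (n₀ : ℕ), ∀ n, n₀ ≤ n → ∀ i : Fin (2 ^ n),
      stateEntropy μ X Y S n i * (1 - stateEntropy μ X Y S n i) ≤
        ε + C * (indexEntropy μ X Y (n + 1) (child i 0) - stateEntropy μ X Y S n i) := by
  obtain ⟨w, hw, N₀, hN₀⟩ := h.exists_le_statePair
  set D : ℝ := 2 * (Fintype.card 𝒮 : ℝ) ^ 4 / w with hD
  have hD0 : 0 ≤ D := by positivity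
  obtain ⟨C, hC, hgain⟩ := Polar.exists_entropy_gain (ε := ε / (D + 1)) (by positivity)
  refine ⟨D * (2 * C), N₀, fun n hn i => ?_⟩
  have hU := h.discreteMeasurable_U n i
  have hQ := h.discreteMeasurable_Q n i
  have hSQ := h.discreteMeasurable_stateQ n i
  have hS := h.discreteMeasurable_S
  have hmono := h.le_indexEntropy_child_zero i
  rw [stateEntropy, condEntropy_eq_posteriorAvg]
  set J := joint μ (fun ω => polarU X n ω i) (stateQ X Y S n i)
  have hJadd : ∀ q a b, J 0 (q, a, b) + J 1 (q, a, b) =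
      μ.real (stateQ X Y S n i ⁻¹' {(q, a, b)}) := fun q a b => joint_add hU hSQ _
  have hmain := entropy_gain_of_blocks (J := J) (fun _ _ => joint_nonneg _ _ _ _ _)
    (π := fun b => μ.real (S 0 ⁻¹' {b})) h.stationary_pos (fun _ => measureReal_le_one)
    (sum_measureReal_preimage (hS 0))
    (fun b => by
      rw [← h.measureReal_S (2 ^ n), ← sum_measureReal_preimage_prodMk (hQ.prodMk (hS 0)) (hS _)]
      refine Finset.sum_congr rfl fun k _ => ?_
      rw [hJadd]
      congr 1
      ext ω
      simp [stateQ, Prod.ext_iff, and_assoc])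
    (fun b => by
      rw [← sum_measureReal_preimage_prodMk (hQ.prodMk (hS (2 ^ n))) (hS _)]
      refine Finset.sum_congr rfl fun k _ => ?_
      rw [hJadd]
      congr 1
      ext ω
      simp only [stateQ, Set.mem_preimage, Set.mem_singleton_iff, Prod.ext_iff]
      tauto)
    hw
    (fun a b => by
      refine (hN₀ (2 ^ n) (hn.trans Nat.lt_two_pow_self.le) a b).trans_eq ?_
      rw [statePair, Nat.cast_pow, Nat.cast_ofNat,
        ← sum_measureReal_preimage_prodMk hQ ((hS 0).prodMk (hS (2 ^ n)))]
      exact Finset.sum_congr rfl fun q _ => (hJadd q a b).symm)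
    hgain
  refine hmain.trans ?_
  rw [← hD, mul_add, ← mul_assoc]
  refine add_le_add ?_ (mul_le_mul_of_nonneg_left (sub_le_sub_right hmono _) (by positivity))
  rw [mul_div_assoc', div_le_iff₀ (by positivity)]
  nlinarith

end Blocks

/-! ### The random index -/

section RandomIndex

theorem exists_child_eq_iff {n : ℕ} {T : Set (Fin (2 ^ n))} {i : Fin (2 ^ n)} {b : Fin 2} :
    (∃ i' ∈ T, ∃ b', child i' b' = child i b) ↔ i ∈ T := by
  simp [child_inj]

theorem sum_child {n : ℕ} (f : Fin (2 ^ (n + 1)) → ℝ) :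
    ∑ k, f k = ∑ i : Fin (2 ^ n), (f (child i 0) + f (child i 1)) := by
  have hbij : Function.Bijective fun p : Fin (2 ^ n) × Fin 2 => child p.1 p.2 :=
    ⟨fun p p' h => Prod.ext_iff.2 (child_inj.1 h), fun k =>
      let ⟨i, b, h⟩ := child_surjective k
      ⟨(i, b), h⟩⟩
  rw [← hbij.sum_comp, Fintype.sum_prod_type]
  exact Finset.sum_congr rfl fun i _ => Fin.sum_univ_two _

theorem randIndex_succ {Ω' : Type*} (B : ℕ → Ω' → Fin 2) (n : ℕ) (ω : Ω') :
    randIndex B (n + 1) ω = child (randIndex B n ω) (B n ω) := by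
  rw [randIndex, randIndex, ← ofDigits_snoc]
  congr 1
  funext j
  refine Fin.lastCases ?_ (fun j => ?_) j
  · simp
  · simp

theorem preimage_randIndex_succ {Ω' : Type*} (B : ℕ → Ω' → Fin 2) {n : ℕ}
    (T : Set (Fin (2 ^ n))) :
    randIndex B (n + 1) ⁻¹' {k | ∃ i ∈ T, ∃ b, child i b = k} = randIndex B n ⁻¹' T := by
  ext ω
  simp only [Set.mem_preimage, Set.mem_ofPred_eq, randIndex_succ, exists_child_eq_iff]

variable {Ω' : Type*} [MeasurableSpace Ω'] {P : Measure Ω'} {B : ℕ → Ω' → Fin 2}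

theorem IsFairBits.measurable_randIndex (hB : IsFairBits P B) (n : ℕ) :
    Measurable (randIndex B n) :=
  (measurable_of_finite _).comp (measurable_pi_lambda _ fun j : Fin n => hB.measurable j)

/-- The random index is uniformly distributed. -/
theorem IsFairBits.measure_randIndex (hB : IsFairBits P B) (n : ℕ) (i : Fin (2 ^ n)) :
    P.real (randIndex B n ⁻¹' {i}) = (1 / 2) ^ n := by
  obtain ⟨d, rfl⟩ := (ofDigits n).surjective i
  have hind := (hB.indep.precomp (g := fun j : Fin n => (j : ℕ))
    Fin.val_injective).measure_inter_preimage_eq_mul Finset.univ (sets := fun j => {d j})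
    fun _ _ => measurableSet_singleton _
  have e : randIndex B n ⁻¹' {ofDigits n d} =
      ⋂ j ∈ (Finset.univ : Finset (Fin n)), B j ⁻¹' {d j} := by
    ext ω
    simp [randIndex, funext_iff]
  have hu : ∀ j : Fin n, P (B j ⁻¹' {d j}) = 1 / 2 := fun j => hB.uniform j (d j)
  rw [measureReal_def, e, hind, Finset.prod_congr rfl fun j _ => hu j]
  simp

/-- The filtration generated by the random indices, that is, by the bits. -/
def indexFiltration (hB : IsFairBits P B) : Filtration ℕ ‹MeasurableSpace Ω'› where
  seq n := MeasurableSpace.comap (randIndex B n) ⊤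
  mono' := monotone_nat_of_le_succ fun n => by
    rintro _ ⟨T, -, rfl⟩
    exact ⟨{k | ∃ i ∈ T, ∃ b, child i b = k}, trivial, preimage_randIndex_succ B T⟩
  le' n := by
    rintro _ ⟨T, -, rfl⟩
    exact hB.measurable_randIndex n (Set.toFinite T).measurableSet

variable [IsProbabilityMeasure P]

theorem IsFairBits.integral_randIndex (hB : IsFairBits P B) (n : ℕ) (g : Fin (2 ^ n) → ℝ) :
    ∫ ω, g (randIndex B n ω) ∂P = (1 / 2) ^ n * ∑ i, g i := by
  have hm := hB.measurable_randIndex n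
  have : IsProbabilityMeasure (P.map (randIndex B n)) :=
    Measure.isProbabilityMeasure_map hm.aemeasurable
  rw [← integral_map (φ := randIndex B n) hm.aemeasurable
    (measurable_of_finite g).aestronglyMeasurable, integral_fintype Integrable.of_finite,
    Finset.mul_sum]
  refine Finset.sum_congr rfl fun i _ => ?_
  rw [map_measureReal_apply hm (measurableSet_singleton i), hB.measure_randIndex, smul_eq_mul]

theorem IsFairBits.setIntegral_randIndex (hB : IsFairBits P B) (n : ℕ) (g : Fin (2 ^ n) → ℝ)
    (T : Set (Fin (2 ^ n))) :
    ∫ ω in randIndex B n ⁻¹' T, g (randIndex B n ω) ∂P = (1 / 2) ^ n * ∑ i, T.indicator g i := by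
  rw [← hB.integral_randIndex, ← integral_indicator
    (hB.measurable_randIndex n (Set.toFinite T).measurableSet)]
  rfl

/-- A bounded parameter of an index that does not increase on average in one step converges
almost surely along the random index. -/
theorem IsFairBits.exists_ae_tendsto (hB : IsFairBits P B) {F : ∀ n, Fin (2 ^ n) → ℝ}
    (h01 : ∀ n i, F n i ∈ Set.Icc (0 : ℝ) 1)
    (hF : ∀ n i, F (n + 1) (child i 0) + F (n + 1) (child i 1) ≤ 2 * F n i) :
    ∃ L : Ω' → ℝ, Measurable L ∧
      ∀ᵐ ω ∂P, Tendsto (fun n => F n (randIndex B n ω)) atTop (𝓝 (L ω)) := by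
  set f : ℕ → Ω' → ℝ := fun n ω => F n (randIndex B n ω) with hf
  have hmeas : ∀ n, Measurable (f n) := fun n =>
    (measurable_of_finite _).comp (hB.measurable_randIndex n)
  have hbdd : ∀ n, ∀ᵐ ω ∂P, ‖(-f) n ω‖ ≤ 1 := fun n => Eventually.of_forall fun ω => by
    rw [Pi.neg_apply, Pi.neg_apply, norm_neg, Real.norm_of_nonneg (h01 n _).1]
    exact (h01 n _).2
  have hsuper : Supermartingale f (indexFiltration hB) P := by
    refine supermartingale_of_setIntegral_succ_le (fun n => ?_) (fun n => ?_) fun n s hs => ?_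
    · have : Measurable[MeasurableSpace.comap (randIndex B n) ⊤] (randIndex B n) := by
        intro t _
        exact ⟨t, trivial, rfl⟩
      exact ((measurable_of_finite (F n)).comp this).stronglyMeasurable
    · exact Integrable.of_bound (hmeas n).aestronglyMeasurable 1
        ((hbdd n).mono fun ω h => by simpa using h)
    · obtain ⟨T, -, rfl⟩ := hs
      rw [hB.setIntegral_randIndex n (F n) T, ← preimage_randIndex_succ,
        hB.setIntegral_randIndex (n + 1) (F (n + 1)), sum_child, pow_succ, mul_assoc]
      refine mul_le_mul_of_nonneg_left ?_ (by positivity)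
      rw [Finset.mul_sum]
      refine Finset.sum_le_sum fun i _ => ?_
      classical
      simp only [Set.indicator_apply, Set.mem_ofPred_eq, exists_child_eq_iff]
      split_ifs
      · linarith [hF n i]
      · simp
  have hlim := hsuper.neg.ae_tendsto_limitProcess (R := 1) fun n => by
    simpa using eLpNorm_le_of_ae_bound (p := 1) (hbdd n)
  obtain ⟨g, hg, hlim⟩ : ∃ g : Ω' → ℝ, Measurable g ∧
      ∀ᵐ ω ∂P, Tendsto (fun n => (-f) n ω) atTop (𝓝 (g ω)) :=
    ⟨_, Filtration.stronglyMeasurable_limit_process'.measurable, hlim⟩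
  refine ⟨fun ω => -g ω, hg.neg, ?_⟩
  filter_upwards [hlim] with ω hω
  simpa [hf] using hω.neg

/-- Nonnegative parameters of an index whose sum over all indices stays bounded tend to zero
almost surely along the random index. -/
theorem IsFairBits.ae_tendsto_zero (hB : IsFairBits P B) {D : ∀ n, Fin (2 ^ n) → ℝ} {C : ℝ}
    (h0 : ∀ n i, 0 ≤ D n i) (hC : ∀ n, ∑ i, D n i ≤ C) :
    ∀ᵐ ω ∂P, Tendsto (fun n => D n (randIndex B n ω)) atTop (𝓝 0) := by
  have hmeas : ∀ n, Measurable fun ω => D n (randIndex B n ω) := fun n =>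
    (measurable_of_finite _).comp (hB.measurable_randIndex n)
  have hint : ∀ n, ∫⁻ ω, ENNReal.ofReal (D n (randIndex B n ω)) ∂P ≤
      ENNReal.ofReal ((1 / 2) ^ n * C) := by
    intro n
    rw [← ofReal_integral_eq_lintegral_ofReal, hB.integral_randIndex]
    · exact ENNReal.ofReal_le_ofReal (mul_le_mul_of_nonneg_left (hC n) (by positivity))
    · refine Integrable.of_bound (hmeas n).aestronglyMeasurable (∑ i, D n i)
        (Eventually.of_forall fun ω => ?_)
      rw [Real.norm_of_nonneg (h0 n _)]
      exact Finset.single_le_sum (fun i _ => h0 n i) (Finset.mem_univ _)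
    · exact Eventually.of_forall fun ω => h0 n _
  have hC0 : 0 ≤ C := (Finset.sum_nonneg fun i _ => h0 0 i).trans (hC 0)
  have hsum : ∫⁻ ω, ∑' n, ENNReal.ofReal (D n (randIndex B n ω)) ∂P ≠ ⊤ := by
    rw [lintegral_tsum fun n => (hmeas n).ennreal_ofReal.aemeasurable]
    refine ne_top_of_le_ne_top ?_ (ENNReal.tsum_le_tsum hint)
    exact (summable_geometric_two.mul_right C).tsum_ofReal_ne_top
  filter_upwards [ae_lt_top (Measurable.tsum fun n => (hmeas n).ennreal_ofReal) hsum]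
    with ω hω
  have := (ENNReal.tendsto_toReal ENNReal.zero_ne_top).comp
    (ENNReal.tendsto_atTop_zero_of_tsum_ne_top hω.ne)
  simpa [Function.comp_def, ENNReal.toReal_ofReal (h0 _ _)] using this

theorem IsFairBits.ae_frequently_eq_zero (hB : IsFairBits P B) :
    ∀ᵐ ω ∂P, ∃ᶠ n in atTop, B n ω = 0 := by
  have hm : ∀ n, MeasurableSet (B n ⁻¹' {0}) := fun n =>
    hB.measurable n (measurableSet_singleton 0)
  have hind : iIndepSet (fun n => B n ⁻¹' {0}) P := (iIndepSet_iff_meas_biInter hm).2 fun s =>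
    hB.indep.measure_inter_preimage_eq_mul s fun _ _ => measurableSet_singleton _
  have hu : ∀ n, P (B n ⁻¹' {0}) = 1 / 2 := fun n => hB.uniform n 0
  have hlim := measure_limsup_eq_one hm hind (by
    simp only [hu]
    exact ENNReal.tsum_const_eq_top_of_ne_zero (by simp))
  have hae := (mem_ae_iff_prob_eq_one (MeasurableSet.measurableSet_limsup hm)).2 hlim
  filter_upwards [hae] with ω hω
  have hfreq := mem_limsup_iff_frequently_mem.1 hω
  exact hfreq

end RandomIndex

/-! ### Polarization -/

section Polarization

/-- Averages over the posterior of functions that, like the entropy, vanish at deterministic bits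
and equal `1` at uniform ones are controlled by the entropy near both extremes. -/
theorem exists_posteriorAvg_le {φ : ℝ → ℝ} (hφ : Continuous φ) (h0 : φ 0 = 0) (h1 : φ 1 = 0)
    (h2 : φ 2⁻¹ = 1) {ε : ℝ} (hε : 0 < ε) : ∃ C : ℝ, ∀ (𝒬 : Type*) [Fintype 𝒬]
      (J : ZMod 2 → 𝒬 → ℝ), (∀ u q, 0 ≤ J u q) → ∑ q, (J 0 q + J 1 q) = 1 →
        posteriorAvg φ J ≤ ε + C * posteriorAvg hFun J ∧
          1 - posteriorAvg φ J ≤ ε + C * (1 - posteriorAvg hFun J) := by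
  obtain ⟨C₁, hC₁, H₁⟩ := exists_le_add_mul_of_isCompact
    (isCompact_Icc : IsCompact (Set.Icc (0 : ℝ) 1)) hFun_continuous hφ
    (fun p hp => hFun_nonneg hp) (fun p _ hp => by
      rcases hFun_eq_zero.1 hp with rfl | rfl
      · exact h0.le
      · exact h1.le) hε
  obtain ⟨C₂, hC₂, H₂⟩ := exists_le_add_mul_of_isCompact
    (isCompact_Icc : IsCompact (Set.Icc (0 : ℝ) 1)) (f := fun p => 1 - hFun p)
    (g := fun p => 1 - φ p) (continuous_const.sub hFun_continuous)
    (by fun_prop) (fun p _ => by linarith [hFun_le_one p])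
    (fun p _ hp => by
      have : p = 2⁻¹ := hFun_eq_one.1 (by linarith)
      rw [this, h2, sub_self]) hε
  refine ⟨max C₁ C₂, fun 𝒬 _ J hJ hJ1 => ⟨?_, ?_⟩⟩
  · refine posteriorAvg_le_add_mul hJ hJ1 fun p hp => (H₁ p hp).trans ?_
    have := mul_le_mul_of_nonneg_right (le_max_left C₁ C₂) (hFun_nonneg hp)
    linarith
  · rw [← posteriorAvg_one_sub hJ1, ← posteriorAvg_one_sub hJ1]
    refine posteriorAvg_le_add_mul hJ hJ1 fun p hp => (H₂ p hp).trans ?_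
    have := mul_le_mul_of_nonneg_right (le_max_right C₁ C₂)
      (by linarith [hFun_le_one p] : 0 ≤ 1 - hFun p)
    linarith

theorem tendsto_zero_of_forall_le_add_mul {α β : ℕ → ℝ} (hα : Tendsto α atTop (𝓝 0))
    (hβ : ∀ n, 0 ≤ β n) (h : ∀ ε > 0, ∃ C : ℝ, ∀ n, β n ≤ ε + C * α n) :
    Tendsto β atTop (𝓝 0) := by
  rw [tendsto_order]
  refine ⟨fun a ha => Eventually.of_forall fun n => ha.trans_le (hβ n), fun a ha => ?_⟩
  obtain ⟨C, hC⟩ := h (a / 2) (by linarith)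
  have : Tendsto (fun n => a / 2 + C * α n) atTop (𝓝 (a / 2 + C * 0)) :=
    (hα.const_mul C).const_add _
  filter_upwards [this.eventually_lt_const (show a / 2 + C * 0 < a by linarith)] with n hn
  exact (hC n).trans_lt hn

variable {Ω' : Type*} [MeasurableSpace Ω'] {P : Measure Ω'} {B : ℕ → Ω' → Fin 2}

/-- If the entropies along the random index converge to a `{0,1}`-valued limit, then so do the
averages of any function that vanishes at deterministic bits and equals `1` at uniform ones. -/
theorem polarizesTo_posteriorAvg (hB : IsFairBits P B) {𝒬 : ∀ n, Fin (2 ^ n) → Type*}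
    [∀ n i, Fintype (𝒬 n i)] {J : ∀ n i, ZMod 2 → 𝒬 n i → ℝ} (hJ : ∀ n i u q, 0 ≤ J n i u q)
    (hJ1 : ∀ n i, ∑ q, (J n i 0 q + J n i 1 q) = 1) {φ : ℝ → ℝ} (hφ : Continuous φ)
    (h01 : ∀ p ∈ Set.Icc (0 : ℝ) 1, φ p ∈ Set.Icc (0 : ℝ) 1) (h0 : φ 0 = 0) (h1 : φ 1 = 0)
    (h2 : φ 2⁻¹ = 1) {L : Ω' → ℝ} (hL : Measurable L) (hL01 : ∀ ω, L ω = 0 ∨ L ω = 1)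
    (hlim : ∀ᵐ ω ∂P, Tendsto
      (fun n => posteriorAvg hFun (J n (randIndex B n ω))) atTop (𝓝 (L ω))) :
    PolarizesTo P (fun n ω => posteriorAvg φ (J n (randIndex B n ω))) L where
  measurable n := (measurable_of_finite fun i => posteriorAvg φ (J n i)).comp
    (hB.measurable_randIndex n)
  mem_Icc n ω := posteriorAvg_mem_Icc (hJ n _) (hJ1 n _) h01
  measurable_lim := hL
  lim_eq := hL01
  tendsto := by
    filter_upwards [hlim] with ω hω
    have hI := fun n => posteriorAvg_mem_Icc (hJ n (randIndex B n ω)) (hJ1 n _) h01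
    rcases hL01 ω with h | h
    · rw [h] at hω ⊢
      refine tendsto_zero_of_forall_le_add_mul hω (fun n => (hI n).1) fun ε hε => ?_
      obtain ⟨C, hC⟩ := exists_posteriorAvg_le hφ h0 h1 h2 hε
      exact ⟨C, fun n => (hC _ _ (hJ n _) (hJ1 n _)).1⟩
    · rw [h] at hω ⊢
      have hω' := hω.const_sub 1
      rw [sub_self] at hω'
      have := tendsto_zero_of_forall_le_add_mul hω'
        (fun n => sub_nonneg.2 (hI n).2) fun ε hε => by
          obtain ⟨C, hC⟩ := exists_posteriorAvg_le hφ h0 h1 h2 hε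
          exact ⟨C, fun n => (hC _ _ (hJ n _) (hJ1 n _)).2⟩
      simpa using this.const_sub 1

theorem PolarizesTo.one_sub {A : ℕ → Ω' → ℝ} {L : Ω' → ℝ} (h : PolarizesTo P A L) :
    PolarizesTo P (fun n ω => 1 - A n ω) (fun ω => 1 - L ω) where
  measurable n := (h.measurable n).const_sub 1
  mem_Icc n ω := ⟨by linarith [(h.mem_Icc n ω).2], by linarith [(h.mem_Icc n ω).1]⟩
  measurable_lim := h.measurable_lim.const_sub 1
  lim_eq ω := by rcases h.lim_eq ω with h | h <;> simp [h]
  tendsto := h.tendsto.mono fun _ hω => hω.const_sub 1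

variable {Ω 𝒴 𝒮 : Type*} [MeasurableSpace Ω]
  [Fintype 𝒴] [MeasurableSpace 𝒴] [MeasurableSingletonClass 𝒴]
  [Fintype 𝒮] [MeasurableSpace 𝒮] [MeasurableSingletonClass 𝒮]
  {μ : Measure Ω} [IsProbabilityMeasure μ]
  {X : ℤ → Ω → ZMod 2} {Y : ℤ → Ω → 𝒴} {S : ℤ → Ω → 𝒮}

/-- The entropies converge almost surely, with and without knowledge of the boundary states, to
a common `{0,1}`-valued limit. -/
theorem IsFAIM.exists_entropy_limit [IsProbabilityMeasure P] (h : IsFAIM μ X Y S)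
    (hB : IsFairBits P B) : ∃ L : Ω' → ℝ, Measurable L ∧ (∀ ω, L ω = 0 ∨ L ω = 1) ∧
      ∀ᵐ ω ∂P, Tendsto (fun n => indexEntropy μ X Y n (randIndex B n ω)) atTop (𝓝 (L ω)) ∧
        Tendsto (fun n => stateEntropy μ X Y S n (randIndex B n ω)) atTop (𝓝 (L ω)) := by
  have h01 : ∀ n i, indexEntropy μ X Y n i ∈ Set.Icc (0 : ℝ) 1 := fun n i => by
    rw [indexEntropy, condEntropy_eq_posteriorAvg]
    exact posteriorAvg_mem_Icc (fun _ _ => joint_nonneg _ _ _ _ _)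
      (sum_joint (h.discreteMeasurable_U n i) (h.discreteMeasurable_Q n i))
      fun p hp => ⟨hFun_nonneg hp, hFun_le_one p⟩
  obtain ⟨L, hL, hlim⟩ := hB.exists_ae_tendsto h01 fun n i => h.indexEntropy_child_add_le i
  have hdiff := hB.ae_tendsto_zero (D := fun n i => indexEntropy μ X Y n i -
    stateEntropy μ X Y S n i) (fun n i => sub_nonneg.2 (h.stateEntropy_le n i))
    h.sum_indexEntropy_sub_le
  have hzero : ∀ᵐ ω ∂P, (Tendsto (fun n => indexEntropy μ X Y n (randIndex B n ω)) atTop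
      (𝓝 (L ω)) ∧ Tendsto (fun n => stateEntropy μ X Y S n (randIndex B n ω)) atTop
      (𝓝 (L ω))) ∧ (L ω = 0 ∨ L ω = 1) := by
    filter_upwards [hlim, hdiff, hB.ae_frequently_eq_zero] with ω hω hd hfreq
    have hs : Tendsto (fun n => stateEntropy μ X Y S n (randIndex B n ω)) atTop (𝓝 (L ω)) := by
      simpa using hω.sub hd
    refine ⟨⟨hω, hs⟩, ?_⟩
    have hI : L ω ∈ Set.Icc (0 : ℝ) 1 :=
      isClosed_Icc.mem_of_tendsto hω (Eventually.of_forall fun n => h01 n _)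
    -- along the steps to first descendants the entropy gain vanishes in the limit
    have hle : L ω * (1 - L ω) ≤ 0 := by
      refine le_of_forall_pos_le_add fun ε hε => ?_
      obtain ⟨C, n₀, hC⟩ := h.exists_entropy_gain hε
      have hr : Tendsto (fun n => ε + C * (indexEntropy μ X Y (n + 1) (randIndex B (n + 1) ω) -
          stateEntropy μ X Y S n (randIndex B n ω))) atTop (𝓝 (ε + C * (L ω - L ω))) :=
        ((((tendsto_add_atTop_iff_nat 1).2 hω).sub hs).const_mul C).const_add ε
      rw [sub_self, mul_zero, add_zero] at hr
      rw [zero_add]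
      refine le_of_tendsto_of_tendsto_of_frequently (hs.mul (hs.const_sub 1)) hr ?_
      refine (hfreq.and_eventually (eventually_ge_atTop n₀)).mono fun n hn => ?_
      rw [randIndex_succ, hn.1]
      exact hC n hn.2 _
    have hge := mul_nonneg hI.1 (sub_nonneg.2 hI.2)
    rcases mul_eq_zero.1 (le_antisymm hle hge) with h0 | h1
    · exact Or.inl h0
    · exact Or.inr (by linarith)
  -- a version of the limit that takes the values `0` and `1` everywhere
  refine ⟨{ω | L ω = 1}.indicator 1, ?_, fun ω => ?_, ?_⟩
  · exact measurable_one.indicator (hL (measurableSet_singleton 1))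
  · by_cases hω : L ω = 1
    · exact Or.inr (Set.indicator_of_mem (s := {ω | L ω = 1}) hω _)
    · exact Or.inl (Set.indicator_of_notMem (s := {ω | L ω = 1}) hω _)
  · filter_upwards [hzero] with ω hω
    have e : {ω | L ω = 1}.indicator (1 : Ω' → ℝ) ω = L ω := by
      rcases hω.2 with h0 | h1
      · rw [h0]
        exact Set.indicator_of_notMem (s := {ω | L ω = 1}) (by simp [h0]) _
      · rw [h1]
        exact Set.indicator_of_mem (s := {ω | L ω = 1}) h1 _
    rw [e]
    exact hω.1

end Polarization

end Polar

theorem mainTheorem4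
    {Ω Ω' 𝒴 𝒮 : Type*} [MeasurableSpace Ω] [MeasurableSpace Ω']
    [Fintype 𝒴] [MeasurableSpace 𝒴] [MeasurableSingletonClass 𝒴]
    [Fintype 𝒮] [MeasurableSpace 𝒮] [MeasurableSingletonClass 𝒮]
    (μ : Measure Ω) [IsProbabilityMeasure μ]
    (X : ℤ → Ω → ZMod 2) (Y : ℤ → Ω → 𝒴) (S : ℤ → Ω → 𝒮)
    (hFAIM : Polar.IsFAIM μ X Y S)
    (P : Measure Ω') [IsProbabilityMeasure P]
    (B : ℕ → Ω' → Fin 2) (hB : Polar.IsFairBits P B) :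
    ∃ Hinf : Ω' → ℝ, Polar.PolarizesTo P (Polar.Hproc μ X Y B) Hinf ∧
      (∃ Zinf Zhatinf : Ω' → ℝ,
        Polar.PolarizesTo P (Polar.Zproc μ X Y B) Zinf ∧
        Polar.PolarizesTo P (Polar.Zhat μ X Y S B) Zhatinf ∧
        (∀ᵐ ω ∂P, Zinf ω = Hinf ω ∧ Zhatinf ω = Hinf ω)) ∧
      (∃ Kinf Khatinf : Ω' → ℝ,
        Polar.PolarizesTo P (Polar.Kproc μ X Y B) Kinf ∧
        Polar.PolarizesTo P (Polar.Khat μ X Y S B) Khatinf ∧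
        (∀ᵐ ω ∂P, Kinf ω = 1 - Hinf ω ∧ Khatinf ω = 1 - Hinf ω)) := by
  open Polar in
  obtain ⟨L, hL, hL01, hlim⟩ := hFAIM.exists_entropy_limit hB
  set J := fun n (i : Fin (2 ^ n)) => joint μ (fun ω => polarU X n ω i) (polarQ X Y n i)
  set Js := fun n (i : Fin (2 ^ n)) => joint μ (fun ω => polarU X n ω i) (stateQ X Y S n i)
  have hJ1 : ∀ n i, ∑ q, (J n i 0 q + J n i 1 q) = 1 := fun n i =>
    sum_joint (hFAIM.discreteMeasurable_U n i) (hFAIM.discreteMeasurable_Q n i)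
  have hJs1 : ∀ n i, ∑ q, (Js n i 0 q + Js n i 1 q) = 1 := fun n i =>
    sum_joint (hFAIM.discreteMeasurable_U n i) (hFAIM.discreteMeasurable_stateQ n i)
  have hlimJ : ∀ᵐ ω ∂P, Tendsto (fun n => posteriorAvg hFun (J n (randIndex B n ω))) atTop
      (𝓝 (L ω)) := hlim.mono fun ω hω => by
    simpa only [indexEntropy, condEntropy_eq_posteriorAvg] using hω.1
  have hlimJs : ∀ᵐ ω ∂P, Tendsto (fun n => posteriorAvg hFun (Js n (randIndex B n ω))) atTop
      (𝓝 (L ω)) := hlim.mono fun ω hω => by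
    simpa only [stateEntropy, condEntropy_eq_posteriorAvg] using hω.2
  have hstate : ∀ (φ : ℝ → ℝ) n (i : Fin (2 ^ n)),
      stateInformed μ (S 0) (S (2 ^ n)) (fun ν => posteriorAvg φ (joint ν
        (fun ω => polarU X n ω i) (polarQ X Y n i))) = posteriorAvg φ (Js n i) := fun φ n i =>
    stateInformed_posteriorAvg φ (hFAIM.discreteMeasurable_S 0) (hFAIM.discreteMeasurable_S _)
  have eH : Hproc μ X Y B = fun n ω => posteriorAvg hFun (J n (randIndex B n ω)) := by
    funext n ω
    exact condEntropy_eq_posteriorAvg _ _ _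
  have eZ : Zproc μ X Y B = fun n ω => posteriorAvg zFun (J n (randIndex B n ω)) := by
    funext n ω
    exact bhattacharyya_eq_posteriorAvg _ _ _
  have eZs : Zhat μ X Y S B = fun n ω => posteriorAvg zFun (Js n (randIndex B n ω)) := by
    funext n ω
    simp only [Zhat, bhattacharyya_eq_posteriorAvg, hstate]
  have eK : Kproc μ X Y B =
      fun n ω => 1 - posteriorAvg (fun p => 1 - kFun p) (J n (randIndex B n ω)) := by
    funext n ω
    rw [posteriorAvg_one_sub (hJ1 _ _), sub_sub_cancel]
    exact totalVariation_eq_posteriorAvg _ _ _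
  have eKs : Khat μ X Y S B =
      fun n ω => 1 - posteriorAvg (fun p => 1 - kFun p) (Js n (randIndex B n ω)) := by
    funext n ω
    rw [posteriorAvg_one_sub (hJs1 _ _), sub_sub_cancel]
    simp only [Khat, totalVariation_eq_posteriorAvg, hstate]
  have hJ0 : ∀ n i u q, 0 ≤ J n i u q := fun _ _ _ _ => joint_nonneg _ _ _ _ _
  have hJs0 : ∀ n i u q, 0 ≤ Js n i u q := fun _ _ _ _ => joint_nonneg _ _ _ _ _
  have hz01 : ∀ p ∈ Set.Icc (0 : ℝ) 1, zFun p ∈ Set.Icc (0 : ℝ) 1 :=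
    fun p _ => ⟨zFun_nonneg p, zFun_le_one p⟩
  have hz2 : zFun 2⁻¹ = 1 := by
    rw [zFun, show (2⁻¹ : ℝ) * (1 - 2⁻¹) = 2⁻¹ ^ 2 by norm_num, Real.sqrt_sq (by norm_num)]
    norm_num
  have hk : Continuous fun p => 1 - kFun p := continuous_const.sub kFun_continuous
  have hk01 : ∀ p ∈ Set.Icc (0 : ℝ) 1, 1 - kFun p ∈ Set.Icc (0 : ℝ) 1 :=
    fun p hp => ⟨by linarith [kFun_le_one hp], by linarith [kFun_nonneg p]⟩
  refine ⟨L, ?_, ⟨L, L, ?_, ?_, ae_of_all _ fun ω => ⟨rfl, rfl⟩⟩,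
    ⟨fun ω => 1 - L ω, fun ω => 1 - L ω, ?_, ?_, ae_of_all _ fun ω => ⟨rfl, rfl⟩⟩⟩
  · rw [eH]
    exact polarizesTo_posteriorAvg hB hJ0 hJ1 hFun_continuous
      (fun p hp => ⟨hFun_nonneg hp, hFun_le_one p⟩) (hFun_eq_zero.2 (Or.inl rfl))
      (hFun_eq_zero.2 (Or.inr rfl)) (hFun_eq_one.2 rfl) hL hL01 hlimJ
  · rw [eZ]
    exact polarizesTo_posteriorAvg hB hJ0 hJ1 zFun_continuous hz01 (by simp [zFun])
      (by simp [zFun]) hz2 hL hL01 hlimJ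
  · rw [eZs]
    exact polarizesTo_posteriorAvg hB hJs0 hJs1 zFun_continuous hz01 (by simp [zFun])
      (by simp [zFun]) hz2 hL hL01 hlimJs
  · rw [eK]
    exact (polarizesTo_posteriorAvg hB hJ0 hJ1 hk hk01 (by norm_num [kFun]) (by norm_num [kFun])
      (by norm_num [kFun]) hL hL01 hlimJ).one_sub
  · rw [eKs]
    exact (polarizesTo_posteriorAvg hB hJs0 hJs1 hk hk01 (by norm_num [kFun])
      (by norm_num [kFun]) (by norm_num [kFun]) hL hL01 hlimJs).one_sub
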